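/- **Setting.** Let $\mathbb I_k=\{(t,i):1\le t\le k,\ 1\le i\le k-t+1\}$. Point-target trajectories are $X_p=(t,x^{1:i})\in\mathbb T_{p,k}=\biguplus_{(t,i)\in\mathbb I_k}\{t\}\times\mathbb R^{i n_x}$; extended-target states are $X_e^+=(X_e,\gamma,\tilde X)\in\mathbb T_{e,k}=\mathbb T_{p,k}\times\mathbb R_{+}\times\mathbb S^d_+$ (trajectory, measurement rate, positive definite extent), and $\mathbb T_k=\mathbb T_{p,k}\uplus\mathbb T_{e,k}$ carries Lebesgue measure (sum over $(t,i)$; $\prod_{r\le s}d\tilde X_{rs}$ on $\mathbb S_+^d$). Write $\mathcal N$ for the Gaussian density, $\mathcal N(X;t',m,P)=\mathcal N(x^{1:i};m,P)$ if $X=(t',x^{1:i})$ has the same length as $m$ and $0$ otherwise, $\mathcal G(\gamma;a,b)$ for the Gamma density with shape $a$ and rate $b$, and $$\mathcal{IW}(\tilde X;v,V)=\frac{|V|^{(v-d-1)/2}}{2^{(v-d-1)d/2}\,\Gamma_d(\frac{v-d-1}2)\,|\tilde X|^{v/2}}\,e^{-\frac12\mathrm{tr}(V\tilde X^{-1})},\qquad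 \Gamma_d(a)=\int_{\mathbb S^d_+}|Y|^{a-\frac{d+1}2}e^{-\mathrm{tr}\,Y}dY.$$ *Prior.* The prior PHD is $\lambda=\lambda^p$ on $\mathbb T_{p,k}$, $\lambda=\lambda^e$ on $\mathbb T_{e,k}$, with $$\lambda^p(X_p)=\sum_{i=1}^{J_p}\omega_{p,i}\,\mathcal N(X_p;t_{p,i},m_{p,i},P_{p,i}),\quad \lambda^e(X_e^+)=\sum_{j=1}^{J_e}\omega_{e,j}\,\mathcal G(\gamma;a_j,b_j)\,\mathcal N(X_e;t_{e,j},m_{e,j},P_{e,j})\,\mathcal{IW}(\tilde X;v_j,V_j),$$ where all weights are $\ge0$, all components are alive at time $k$ (birth time $+$ length $=k+1$), all $P$ and $V_j$ are positive definite, $a_j,b_j>0$ and $v_j>2d+2$. *Measurements.* $\mathbf z\subset\mathbb R^d$ is finite; the clutter intensity satisfies $\lambda^C>0$ on $\mathbf z$; $p^D\in[0,1]$; $H\in\mathbb R^{d\times n_x}$; $R$ is positive definite. For point targets $f(\emptyset|X)=1-p^D$, $f(\{z\}|X)=p^D\mathcal N(z;Hx^i,R)$, and $f(\mathbf w|X)=0$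 if $|\mathbf w|>1$. For extended targets $f(\emptyset|X)=1-p^D+p^De^{-\gamma}$ and $f(\mathbf w|X)=p^D\gamma^{|\mathbf w|}e^{-\gamma}\prod_{z\in\mathbf w}\mathcal N(z;Hx^i,\tilde X)$ if $\mathbf w\ne\emptyset$. *Update.* For a joint intensity $g(\mathbf w,X)$ put $\tau_{\mathbf w}=\int g(\mathbf w,X)dX$, $\kappa_{\mathbf w}=\delta_1[|\mathbf w|]\prod_{z\in\mathbf w}\lambda^C(z)$, $w_{\mathcal P}=\prod_{\mathbf w\in\mathcal P}(\kappa_{\mathbf w}+\tau_{\mathbf w})\big/\sum_{\mathcal Q\angle\mathbf z}\prod_{\mathbf w\in\mathcal Q}(\kappa_{\mathbf w}+\tau_{\mathbf w})$ and $$U[g](X)=g(\emptyset,X)+\sum_{\mathcal P\angle\mathbf z}w_{\mathcal P}\sum_{\mathbf w\in\mathcal P}\frac{g(\mathbf w,X)}{\kappa_{\mathbf w}+\tau_{\mathbf w}},$$ the sums being over the partitions of $\mathbf z$ (a quotient with zero denominator is read as $0$). The exact trajectory PHD update $L_{\mathbf z}\lambda$, with pseudolikelihood $L_{\mathbf z}$,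 is $U[f\lambda]$. *The GGIW scheme.* For a cell $\mathbf w\neq\emptyset$ put $\bar z=\frac1{|\mathbf w|}\sum_{z\in\mathbf w}z$, $Z=\sum_{z\in\mathbf w}(z-\bar z)(z-\bar z)^\top$. Let $[k]$ denote the block of the latest time step. For a component $j$ let $\tilde X_j=V_j/(v_j-2d-2)$, $\epsilon_j=\bar z-Hm_{e,j,[k]}$, $S_j(\tilde X)=HP_{e,j,[k,k]}H^\top+\tilde X/|\mathbf w|$, $S_j=S_j(\tilde X_j)$, $K_j(\tilde X)=P_{e,j,[t_j:k,k]}H^\top S_j(\tilde X)^{-1}$, $K_j=K_j(\tilde X_j)$. Let $E\mapsto E^{1/2}$ be any choice of matrix square roots, $E^{1/2}E^{\top/2}=E$ for positive definite $E$. The contribution of component $j$ to $f(\mathbf w|X)\lambda^e(X)$ is $$\omega_{e,j}p^D\gamma^{|\mathbf w|}e^{-\gamma}\,\mathcal G(\gamma;a_j,b_j)\;c_{\mathbf w}(\tilde X)\;\mathcal N(\bar z;Hm_{e,j,[k]},S_j(\tilde X))\;\mathcal N\big(X_e;t_{e,j},m_{e,j}+K_j(\tilde X)\epsilon_j,\,P_{e,j}-K_j(\tilde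 X)HP_{e,j,[k,t_j:k]}\big)\;\mathcal{IW}(\tilde X;v_j,V_j),\tag{1}$$ $$c_{\mathbf w}(\tilde X)=(2\pi)^{-(|\mathbf w|-1)d/2}|\mathbf w|^{-d/2}|\tilde X|^{-(|\mathbf w|-1)/2}e^{-\frac12\mathrm{tr}(Z\tilde X^{-1})}.$$ The GGIW joint intensity $g^{\rm GGIW}$ equals $f\lambda$ on point targets and for $\mathbf w=\emptyset$; for extended targets and $\mathbf w\ne\emptyset$ it is the sum over $j$ of (1) in which the innovation covariance $S_j(\tilde X)$ is replaced by $S_j^{1/2}\tilde X_j^{-1/2}\tilde X\tilde X_j^{-\top/2}S_j^{\top/2}$ and the gain $K_j(\tilde X)$ by $K_j$. The updated PHD of the GGIW filter is $\lambda_{k|k}=U[g^{\rm GGIW}]$. **Proposition.** (i) $L_{\mathbf z}\lambda=U[g]$ where $g$ is the joint intensity obtained from (1) without replacement; and the two replacements agree with the exact quantities at $\tilde X=\tilde X_j$. (ii) $g^{\rm GGIW}(\mathbf w,\cdot)$ is integrable for each finite $\mathbf w\subset\mathbb R^d$, and for all $X\in\mathbb T_k$ $$\lambda_{k|k}(X)=\lambda^{ND}(X)+\sum_{\mathcal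 P\angle\mathbf z}\sum_{\mathbf w\in\mathcal P}\lambda^{D}(X,\mathbf w),$$ where the missed-detection part is $$\lambda^{p,ND}(X_p)=\sum_i(1-p^D)\omega_{p,i}\mathcal N(X_p;t_{p,i},m_{p,i},P_{p,i}),$$ $$\lambda^{e,ND}(X_e^+)=\sum_j\omega_{e,j}\mathcal N(X_e;t_{e,j},m_{e,j},P_{e,j})\mathcal{IW}(\tilde X;v_j,V_j)\Big[(1-p^D)\mathcal G(\gamma;a_j,b_j)+p^D\Big(\frac{b_j}{b_j+1}\Big)^{a_j}\mathcal G(\gamma;a_j,b_j+1)\Big],$$ and the detected part (for the cell $\mathbf w$ of $\mathcal P$) is $$\lambda^{p,D}=\sum_i\omega_{p,i}(\mathbf w)\mathcal N(X_p;t_{p,i},m^k_{p,i},P^k_{p,i}),\qquad \lambda^{e,D}=\sum_j\omega_{e,j}(\mathbf w)\mathcal G(\gamma;a_j^k,b_j^k)\mathcal N(X_e;t_{e,j},m^k_{e,j},P^k_{e,j})\mathcal{IW}(\tilde X;v_j^k,V_j^k),$$ with $$\omega_{e,j}(\mathbf w)=\frac{\omega_{\mathcal P}}{d_{\mathbf w}}\omega_{e,j}p^D\frac{q_{e,j}(\mathbf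 w)}{\prod_{z\in\mathbf w}\lambda^C(z)},\quad \omega_{p,i}(\mathbf w)=\frac{\omega_{\mathcal P}}{d_{\mathbf w}}\omega_{p,i}p^D\frac{q_{p,i}(\mathbf w)}{\prod_{z\in\mathbf w}\lambda^C(z)}\delta_1[|\mathbf w|],\quad \omega_{\mathcal P}=\frac{\prod_{\mathbf w\in\mathcal P}d_{\mathbf w}}{\sum_{\mathcal Q\angle\mathbf z}\prod_{\mathbf w\in\mathcal Q}d_{\mathbf w}},$$ $$d_{\mathbf w}=\delta_1[|\mathbf w|]+\sum_l\omega_{e,l}p^D\frac{q_{e,l}(\mathbf w)}{\prod_{z\in\mathbf w}\lambda^C(z)}+\sum_o\omega_{p,o}p^D\frac{q_{p,o}(\mathbf w)}{\prod_{z\in\mathbf w}\lambda^C(z)}\delta_1[|\mathbf w|],$$ $$m^k_{e,j}=m_{e,j}+K_j\epsilon_j,\quad P^k_{e,j}=P_{e,j}-K_jHP_{e,j,[k,t_j:k]},\quad a_j^k=a_j+|\mathbf w|,\quad b_j^k=b_j+1,\quad v_j^k=v_j+|\mathbf w|,$$ $$V_j^k=V_j+N_j+Z,\qquad N_j=\tilde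 X_j^{1/2}S_j^{-1/2}\epsilon_j\epsilon_j^\top S_j^{-\top/2}\tilde X_j^{\top/2},$$ $(m^k_{p,i},P^k_{p,i})$ the Kalman update of $(m_{p,i},P_{p,i})$ by the measurement $z$ of the cell $\mathbf w=\{z\}$, i.e. with gain $P_{p,i,[t_i:k,k]}H^\top(HP_{p,i,[k,k]}H^\top+R)^{-1}$ and innovation $z-Hm_{p,i,[k]}$, and $$q_{p,i}(\{z\})=\mathcal N(z;Hm_{p,i,[k]},HP_{p,i,[k,k]}H^\top+R),$$ $$q_{e,j}(\mathbf w)=(\pi^{|\mathbf w|}|\mathbf w|)^{-d/2}\,\frac{|V_j|^{\frac{v_j-d-1}2}}{|V_j^k|^{\frac{v_j^k-d-1}2}}\cdot\frac{\Gamma_d(\frac{v_j^k-d-1}2)\,|\tilde X_j|^{1/2}\,\Gamma(a_j^k)\,b_j^{a_j}}{\Gamma_d(\frac{v_j-d-1}2)\,|S_j|^{1/2}\,\Gamma(a_j)\,(b_j^k)^{a_j^k}}.$$ (iii) All updated components are again admissible: weights $\ge0$, alive, $P^k$ and $V^k$ positive definite, $a^k,b^k>0$, $v^k>2d+2$. 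-/

import Mathlib

open MeasureTheory
open scoped Matrix

namespace TPHD

noncomputable section

/-! ### The state spaces -/

/-- `𝕀_k`: pairs `(t, i)` of a birth time and a length with `1 ≤ t ≤ k` and
`1 ≤ i ≤ k - t + 1`. -/
def TrajIdx (k : ℕ) : Type :=
  {p : ℕ × ℕ // 1 ≤ p.1 ∧ p.1 ≤ k ∧ 1 ≤ p.2 ∧ p.1 + p.2 ≤ k + 1}

/-- Birth time. -/
def TrajIdx.birth {k : ℕ} (p : TrajIdx k) : ℕ := p.1.1

/-- Length of the trajectory. -/
def TrajIdx.len {k : ℕ} (p : TrajIdx k) : ℕ := p.1.2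

/-- The position of the latest state `x^i` in the sequence `x^{1:i}`. -/
def TrajIdx.last {k : ℕ} (p : TrajIdx k) : Fin p.len :=
  ⟨p.len - 1, Nat.sub_lt p.2.2.2.1 Nat.one_pos⟩

/-- The trajectory is alive at time `k`: `t + i - 1 = k`. -/
def TrajIdx.Alive {k : ℕ} (p : TrajIdx k) : Prop := p.birth + p.len = k + 1

instance instDecidableEqTrajIdx (k : ℕ) : DecidableEq (TrajIdx k) :=
  fun a b => decidable_of_iff (a.1 = b.1) Subtype.ext_iff.symm

/-- Stacked target states `x^{1:i}`: entry `(s, r)` is the `r`-th coordinate of the `s`-th state. -/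
abbrev StateSeq {k : ℕ} (nx : ℕ) (p : TrajIdx k) : Type := Fin p.len × Fin nx → ℝ

/-- The trajectory space `⊎_{(t,i)} {t} × ℝ^{i n_x}`; it is also the space of point-target
trajectories. -/
abbrev Traj (k nx : ℕ) : Type := Σ p : TrajIdx k, StateSeq nx p

/-- The latest target state `x^i` of a trajectory. -/
def Traj.cur {k nx : ℕ} (X : Traj k nx) : Fin nx → ℝ := fun r => X.2 (X.1.last, r)

/-- Positive definite `d × d` matrices. -/
def PDMat (d : ℕ) : Type := {M : Matrix (Fin d) (Fin d) ℝ // M.PosDef}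

/-- The coordinates on or above the diagonal of a symmetric matrix. -/
def upperCoord {d : ℕ} (M : PDMat d) : {p : Fin d × Fin d // p.1 ≤ p.2} → ℝ :=
  fun p => M.1 p.1.1 p.1.2

instance instMeasurableSpacePDMat (d : ℕ) : MeasurableSpace (PDMat d) :=
  MeasurableSpace.comap upperCoord inferInstance

/-- Lebesgue measure `∏_{i ≤ j} dM_{ij}` on positive definite matrices. -/
def pdVolume (d : ℕ) : Measure (PDMat d) := Measure.comap upperCoord volume

/-- Extended-target states `(X_e, γ, X̃)`: trajectory, measurement rate and extent. -/
abbrev ExtState (k nx d : ℕ) : Type := Traj k nx × Set.Ioi (0 : ℝ) × PDMat d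

/-- The coexisting space `𝕋_{p,k} ⊎ 𝕋_{e,k}`. -/
abbrev CoState (k nx d : ℕ) : Type := Traj k nx ⊕ ExtState k nx d

/-- Lebesgue measure on the trajectory space: the integral is the sum over `(t, i)` of the
integrals over `ℝ^{i n_x}`. -/
def trajVolume (k nx : ℕ) : Measure (Traj k nx) :=
  Measure.sum fun p : TrajIdx k =>
    (volume : Measure (StateSeq nx p)).map (fun x => (⟨p, x⟩ : Traj k nx))

/-- Lebesgue measure `dX_e dγ dX̃`. -/
def extVolume (k nx d : ℕ) : Measure (ExtState k nx d) :=
  (trajVolume k nx).prod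
    (((volume : Measure ℝ).comap (Subtype.val : Set.Ioi (0 : ℝ) → ℝ)).prod (pdVolume d))

/-- The reference measure on the coexisting space. -/
def coVolume (k nx d : ℕ) : Measure (CoState k nx d) :=
  (trajVolume k nx).map Sum.inl + (extVolume k nx d).map Sum.inr

/-! ### Densities -/

/-- Gaussian density `𝒩(x; m, P)` on `ℝ^ι`. -/
def gaussPDF {ι : Type} [Fintype ι] [DecidableEq ι] (m : ι → ℝ) (P : Matrix ι ι ℝ)
    (x : ι → ℝ) : ℝ :=
  (2 * Real.pi) ^ (-(Fintype.card ι : ℝ) / 2) * P.det ^ (-(1 : ℝ) / 2) *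
    Real.exp (-(1 / 2) * ((x - m) ⬝ᵥ (P⁻¹ *ᵥ (x - m))))

/-- Multivariate Gamma function `Γ_d(a) = ∫_{X > 0} |X|^{a - (d+1)/2} e^{-tr X} dX`. -/
def multiGamma (d : ℕ) (a : ℝ) : ℝ :=
  ∫ X : PDMat d, X.1.det ^ (a - ((d : ℝ) + 1) / 2) * Real.exp (-X.1.trace) ∂(pdVolume d)

/-- Inverse-Wishart density `ℐ𝒲(X; v, V)`, in the parametrization in which it is proper for
`v > 2d` and has mean `V / (v - 2d - 2)` for `v > 2d + 2`. -/
def invWishartPDF {d : ℕ} (v : ℝ) (V X : Matrix (Fin d) (Fin d) ℝ) : ℝ :=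
  V.det ^ ((v - d - 1) / 2) /
      (2 ^ ((v - d - 1) * d / 2) * multiGamma d ((v - d - 1) / 2) * X.det ^ (v / 2)) *
    Real.exp (-(1 / 2) * (V * X⁻¹).trace)

/-! ### Gaussian and GGIW components -/

/-- Parameters of a weighted Gaussian component on trajectories: the weight, the birth time and
length, the mean and the covariance. -/
structure GaussComp (k nx : ℕ) where
  weight : ℝ
  idx : TrajIdx k
  mean : StateSeq nx idx
  cov : Matrix (Fin idx.len × Fin nx) (Fin idx.len × Fin nx) ℝ

/-- Parameters of a weighted Gamma Gaussian inverse-Wishart component: additionally the Gamma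
shape `a` and rate `b`, and the inverse-Wishart degrees of freedom `v` and matrix `V`. -/
structure ExtComp (k nx d : ℕ) extends GaussComp k nx where
  a : ℝ
  b : ℝ
  v : ℝ
  V : Matrix (Fin d) (Fin d) ℝ

/-- Admissible Gaussian component: nonnegative weight, alive trajectories, nondegenerate
covariance. -/
def GaussComp.Valid {k nx : ℕ} (c : GaussComp k nx) : Prop :=
  0 ≤ c.weight ∧ c.idx.Alive ∧ c.cov.PosDef

/-- Admissible GGIW component; the inverse-Wishart factor has a mean. -/
def ExtComp.Valid {k nx d : ℕ} (c : ExtComp k nx d) : Prop :=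
  c.toGaussComp.Valid ∧ 0 < c.a ∧ 0 < c.b ∧ 2 * (d : ℝ) + 2 < c.v ∧ c.V.PosDef

/-- Trajectory Gaussian density `𝒩(X; t, m, P)` (without the weight): it vanishes unless the
birth time and the length of `X` are those of the component. -/
def GaussComp.density {k nx : ℕ} (c : GaussComp k nx) (X : Traj k nx) : ℝ :=
  if h : X.1 = c.idx then gaussPDF c.mean c.cov (h ▸ X.2) else 0

/-- `ω 𝒩(X; t, m, P)`. -/
def GaussComp.phd {k nx : ℕ} (c : GaussComp k nx) (X : Traj k nx) : ℝ :=
  c.weight * c.density X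

/-- `ω 𝒢(γ; a, b) 𝒩(X_e; t, m, P) ℐ𝒲(X̃; v, V)`. -/
def ExtComp.phd {k nx d : ℕ} (c : ExtComp k nx d) (X : ExtState k nx d) : ℝ :=
  c.weight * ProbabilityTheory.gammaPDFReal c.a c.b X.2.1 * c.density X.1 *
    invWishartPDF c.v c.V X.2.2.1

/-- The PHD of a mixture of point-target Gaussian and extended-target GGIW components. -/
def mixturePHD {k nx d Jp Je : ℕ} (pc : Fin Jp → GaussComp k nx) (ec : Fin Je → ExtComp k nx d) :
    CoState k nx d → ℝ
  | Sum.inl X => ∑ i, (pc i).phd X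
  | Sum.inr X => ∑ j, (ec j).phd X

/-! ### Measurement model -/

/-- A single measurement; it lives in the space of the extent. -/
abbrev Meas (d : ℕ) : Type := Fin d → ℝ

/-- Observation matrix `H`, point-target noise covariance `R`, detection probability `p^D` and
clutter intensity `λ^C`. -/
structure Sensor (nx d : ℕ) where
  H : Matrix (Fin d) (Fin nx) ℝ
  R : Matrix (Fin d) (Fin d) ℝ
  pD : ℝ
  clutter : Meas d → ℝ

/-- The density `f(𝐰 | X)` of the set of measurements generated by one target: the standard point
target model, and the standard (Poisson) extended target model. -/
def Sensor.lik {k nx d : ℕ} (M : Sensor nx d) (w : Finset (Meas d)) : CoState k nx d → ℝ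
  | Sum.inl X =>
      if w.card = 0 then 1 - M.pD
      else if w.card = 1 then M.pD * ∏ z ∈ w, gaussPDF (M.H *ᵥ X.cur) M.R z
      else 0
  | Sum.inr X =>
      if w.card = 0 then 1 - M.pD + M.pD * Real.exp (-(X.2.1 : ℝ))
      else M.pD * (X.2.1 : ℝ) ^ w.card * Real.exp (-(X.2.1 : ℝ)) *
        ∏ z ∈ w, gaussPDF (M.H *ᵥ X.1.cur) X.2.2.1 z

/-! ### The general trajectory PHD update

A *joint intensity* `g 𝐰 X` stands for `f(𝐰 | X) λ(X)`. -/

/-- `κ_𝐰`. -/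
def kappa {d : ℕ} (lamC : Meas d → ℝ) (w : Finset (Meas d)) : ℝ :=
  if w.card = 1 then ∏ z ∈ w, lamC z else 0

/-- `τ_𝐰 = ∫ f(𝐰 | X) λ(X) dX`. -/
def tau {k nx d : ℕ} (g : Finset (Meas d) → CoState k nx d → ℝ) (w : Finset (Meas d)) : ℝ :=
  ∫ X, g w X ∂(coVolume k nx d)

/-- The weight of a partition `P` for given cell factors `h`:
`∏_{𝐰 ∈ P} h(𝐰) / ∑_Q ∏_{𝐰 ∈ Q} h(𝐰)`. -/
def partWeight {d : ℕ} {z : Finset (Meas d)} (h : Finset (Meas d) → ℝ) (P : Finpartition z) : ℝ :=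
  (∏ w ∈ P.parts, h w) / ∑ Q : Finpartition z, ∏ w ∈ Q.parts, h w

/-- The pseudolikelihood `L_𝐳(X)` for a target-generated measurement density `f` and a prior
PHD `lam`. -/
def pseudoLik {k nx d : ℕ} (lamC : Meas d → ℝ) (z : Finset (Meas d))
    (f : Finset (Meas d) → CoState k nx d → ℝ) (lam : CoState k nx d → ℝ)
    (X : CoState k nx d) : ℝ :=
  let g := fun w Y => f w Y * lam Y
  f ∅ X + ∑ P : Finpartition z, partWeight (fun w => kappa lamC w + tau g w) P *
    ∑ w ∈ P.parts, f w X / (kappa lamC w + tau g w)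

/-- The exact update `λ_{k|k}(X) = L_𝐳(X) λ_{k|k-1}(X)`. -/
def phdUpdate {k nx d : ℕ} (lamC : Meas d → ℝ) (z : Finset (Meas d))
    (f : Finset (Meas d) → CoState k nx d → ℝ) (lam : CoState k nx d → ℝ)
    (X : CoState k nx d) : ℝ :=
  pseudoLik lamC z f lam X * lam X

/-- The same update written for a joint intensity `g`, which replaces the products
`f(𝐰 | X) λ(X)` wherever they occur. -/
def jointUpdate {k nx d : ℕ} (lamC : Meas d → ℝ) (z : Finset (Meas d))
    (g : Finset (Meas d) → CoState k nx d → ℝ) (X : CoState k nx d) : ℝ :=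
  g ∅ X + ∑ P : Finpartition z, partWeight (fun w => kappa lamC w + tau g w) P *
    ∑ w ∈ P.parts, g w X / (kappa lamC w + tau g w)

theorem phdUpdate_eq_jointUpdate {k nx d : ℕ} (lamC : Meas d → ℝ) (z : Finset (Meas d))
    (f : Finset (Meas d) → CoState k nx d → ℝ) (lam : CoState k nx d → ℝ)
    (X : CoState k nx d) :
    phdUpdate lamC z f lam X = jointUpdate lamC z (fun w Y => f w Y * lam Y) X := by
  simp only [phdUpdate, jointUpdate, pseudoLik, add_mul, Finset.sum_mul, mul_assoc,
    div_mul_eq_mul_div]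

/-! ### Kalman quantities -/

/-- Mean `z̄` of a cell; for a singleton `{z}` it is `z`. -/
def cellMean {d : ℕ} (w : Finset (Meas d)) : Meas d := (w.card : ℝ)⁻¹ • ∑ z ∈ w, z

/-- Scatter matrix `Z = ∑ (z - z̄)(z - z̄)ᵀ` of a cell. -/
def cellScatter {d : ℕ} (w : Finset (Meas d)) : Matrix (Fin d) (Fin d) ℝ :=
  ∑ z ∈ w, Matrix.vecMulVec (z - cellMean w) (z - cellMean w)

/-- `m_{[k]}`, the mean of the latest state. -/
def GaussComp.meanK {k nx : ℕ} (c : GaussComp k nx) : Fin nx → ℝ := fun r => c.mean (c.idx.last, r)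

/-- `P_{[k,k]}`. -/
def GaussComp.covKK {k nx : ℕ} (c : GaussComp k nx) : Matrix (Fin nx) (Fin nx) ℝ :=
  c.cov.submatrix (fun r => (c.idx.last, r)) (fun r => (c.idx.last, r))

/-- `P_{[t:k,k]}`. -/
def GaussComp.covAllK {k nx : ℕ} (c : GaussComp k nx) :
    Matrix (Fin c.idx.len × Fin nx) (Fin nx) ℝ :=
  c.cov.submatrix id (fun r => (c.idx.last, r))

/-- `P_{[k,t:k]}`. -/
def GaussComp.covKAll {k nx : ℕ} (c : GaussComp k nx) :
    Matrix (Fin nx) (Fin c.idx.len × Fin nx) ℝ :=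
  c.cov.submatrix (fun r => (c.idx.last, r)) id

/-- Innovation covariance `S = H P_{[k,k]} Hᵀ + E` for measurement noise covariance `E`. -/
def GaussComp.innovCov {k nx d : ℕ} (c : GaussComp k nx) (H : Matrix (Fin d) (Fin nx) ℝ)
    (E : Matrix (Fin d) (Fin d) ℝ) : Matrix (Fin d) (Fin d) ℝ :=
  H * c.covKK * Hᵀ + E

/-- Kalman gain `K = P_{[t:k,k]} Hᵀ S⁻¹`. -/
def GaussComp.gain {k nx d : ℕ} (c : GaussComp k nx) (H : Matrix (Fin d) (Fin nx) ℝ)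
    (E : Matrix (Fin d) (Fin d) ℝ) : Matrix (Fin c.idx.len × Fin nx) (Fin d) ℝ :=
  c.covAllK * Hᵀ * (c.innovCov H E)⁻¹

/-- Kalman update of the whole trajectory by a measurement `z` of the latest state with noise
covariance `E`: mean `m + K (z - H m_{[k]})`, covariance `P - K H P_{[k,t:k]}`; the new weight is
`ω`. -/
def GaussComp.kalman {k nx d : ℕ} (c : GaussComp k nx) (H : Matrix (Fin d) (Fin nx) ℝ)
    (E : Matrix (Fin d) (Fin d) ℝ) (z : Meas d) (ω : ℝ) : GaussComp k nx where
  weight := ω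
  idx := c.idx
  mean := c.mean + c.gain H E *ᵥ (z - H *ᵥ c.meanK)
  cov := c.cov - c.gain H E * H * c.covKAll

/-! ### Extended components: exact joint intensity and its GGIW approximation -/

/-- Predicted extent `X̂ = V / (v - 2d - 2)`. -/
def ExtComp.extent {k nx d : ℕ} (c : ExtComp k nx d) : Matrix (Fin d) (Fin d) ℝ :=
  (c.v - 2 * d - 2)⁻¹ • c.V

/-- Noise covariance `E / |𝐰|` of the cell mean for an extent `E`. -/
def meanNoise {d : ℕ} (w : Finset (Meas d)) (E : Matrix (Fin d) (Fin d) ℝ) :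
    Matrix (Fin d) (Fin d) ℝ :=
  (w.card : ℝ)⁻¹ • E

/-- `S = H P_{[k,k]} Hᵀ + X̂ / |𝐰|`. -/
def ExtComp.S {k nx d : ℕ} (c : ExtComp k nx d) (H : Matrix (Fin d) (Fin nx) ℝ)
    (w : Finset (Meas d)) : Matrix (Fin d) (Fin d) ℝ :=
  c.innovCov H (meanNoise w c.extent)

/-- The factor of `∏_{z ∈ 𝐰} 𝒩(z; y, E)` that remains after `𝒩(z̄; y, E / |𝐰|)` is split off; it
does not depend on `y`. -/
def scatterFactor {d : ℕ} (w : Finset (Meas d)) (E : Matrix (Fin d) (Fin d) ℝ) : ℝ :=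
  (2 * Real.pi) ^ (-((w.card : ℝ) - 1) * d / 2) * (w.card : ℝ) ^ (-(d : ℝ) / 2) *
    E.det ^ (-((w.card : ℝ) - 1) / 2) * Real.exp (-(1 / 2) * (cellScatter w * E⁻¹).trace)

/-- The joint intensity of a nonempty cell and an extended target of component `c`, organised by
the Kalman factorisation
`𝒩(z̄; H x^i, X̃/|𝐰|) 𝒩(x; m, P) = 𝒩(z̄; H m_{[k]}, S(X̃)) 𝒩(x; m(X̃), P(X̃))`,
where `innov X̃` is used as innovation covariance in the first factor, and `gainExt X̃` as the
extent from which the updated mean and covariance in the second factor are computed. -/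
def ExtComp.cellJoint {k nx d : ℕ} (c : ExtComp k nx d) (M : Sensor nx d) (w : Finset (Meas d))
    (innov gainExt : Matrix (Fin d) (Fin d) ℝ → Matrix (Fin d) (Fin d) ℝ)
    (X : ExtState k nx d) : ℝ :=
  let E : Matrix (Fin d) (Fin d) ℝ := X.2.2.1
  c.weight * M.pD * ((X.2.1 : ℝ) ^ w.card * Real.exp (-(X.2.1 : ℝ))) *
    ProbabilityTheory.gammaPDFReal c.a c.b X.2.1 *
    scatterFactor w E * gaussPDF (M.H *ᵥ c.meanK) (innov E) (cellMean w) *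
    (c.kalman M.H (meanNoise w (gainExt E)) (cellMean w) 1).density X.1 *
    invWishartPDF c.v c.V E

/-- The exact innovation covariance `S(X̃) = H P_{[k,k]} Hᵀ + X̃ / |𝐰|` as a function of `X̃`. -/
def ExtComp.exactInnov {k nx d : ℕ} (c : ExtComp k nx d) (M : Sensor nx d)
    (w : Finset (Meas d)) (E : Matrix (Fin d) (Fin d) ℝ) : Matrix (Fin d) (Fin d) ℝ :=
  c.innovCov M.H (meanNoise w E)

/-- The innovation covariance of the GGIW scheme,
`S^{1/2} X̂^{-1/2} X̃ X̂^{-⊤/2} S^{⊤/2}`, where `sq` is the chosen matrix square root. -/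
def ExtComp.ggiwInnov {k nx d : ℕ} (c : ExtComp k nx d) (M : Sensor nx d)
    (sq : Matrix (Fin d) (Fin d) ℝ → Matrix (Fin d) (Fin d) ℝ)
    (w : Finset (Meas d)) (E : Matrix (Fin d) (Fin d) ℝ) : Matrix (Fin d) (Fin d) ℝ :=
  let T := sq (c.S M.H w) * (sq c.extent)⁻¹
  T * E * Tᵀ

/-- The joint intensity on the coexisting space: the point-target part and the empty cell are
`f(𝐰 | X) λ(X)`; for extended targets and nonempty cells the Kalman factorisation is used, with
the given innovation covariances and gain extents. -/
def joint {k nx d Jp Je : ℕ} (M : Sensor nx d) (pc : Fin Jp → GaussComp k nx)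
    (ec : Fin Je → ExtComp k nx d)
    (innov gainExt :
      Fin Je → Finset (Meas d) → Matrix (Fin d) (Fin d) ℝ → Matrix (Fin d) (Fin d) ℝ)
    (w : Finset (Meas d)) : CoState k nx d → ℝ
  | Sum.inl X => M.lik w (Sum.inl X : CoState k nx d) * ∑ i, (pc i).phd X
  | Sum.inr X =>
      if w.card = 0 then M.lik w (Sum.inr X : CoState k nx d) * ∑ j, (ec j).phd X
      else ∑ j, (ec j).cellJoint M w (innov j w) (gainExt j w) X

/-- Joint intensity without approximation: true `S(X̃)`, and gains computed from the true `X̃`. -/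
def exactJoint {k nx d Jp Je : ℕ} (M : Sensor nx d) (pc : Fin Jp → GaussComp k nx)
    (ec : Fin Je → ExtComp k nx d) : Finset (Meas d) → CoState k nx d → ℝ :=
  joint M pc ec (fun j w => (ec j).exactInnov M w) (fun _ _ E => E)

/-- Joint intensity of the GGIW scheme: `S(X̃)` is replaced by
`S^{1/2} X̂^{-1/2} X̃ X̂^{-⊤/2} S^{⊤/2}`, and gains are computed from the predicted extent `X̂`. -/
def ggiwJoint {k nx d Jp Je : ℕ} (M : Sensor nx d)
    (sq : Matrix (Fin d) (Fin d) ℝ → Matrix (Fin d) (Fin d) ℝ)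
    (pc : Fin Jp → GaussComp k nx) (ec : Fin Je → ExtComp k nx d) :
    Finset (Meas d) → CoState k nx d → ℝ :=
  joint M pc ec (fun j w => (ec j).ggiwInnov M sq w) (fun j _ _ => (ec j).extent)

/-! ### The closed-form update -/

/-- Innovation `ε = z̄ - H m_{[k]}`. -/
def ExtComp.eps {k nx d : ℕ} (c : ExtComp k nx d) (H : Matrix (Fin d) (Fin nx) ℝ)
    (w : Finset (Meas d)) : Meas d :=
  cellMean w - H *ᵥ c.meanK

/-- `N = X̂^{1/2} S^{-1/2} ε εᵀ S^{-⊤/2} X̂^{⊤/2}`. -/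
def ExtComp.N {k nx d : ℕ} (c : ExtComp k nx d) (H : Matrix (Fin d) (Fin nx) ℝ)
    (sq : Matrix (Fin d) (Fin d) ℝ → Matrix (Fin d) (Fin d) ℝ)
    (w : Finset (Meas d)) : Matrix (Fin d) (Fin d) ℝ :=
  sq c.extent * (sq (c.S H w))⁻¹ * Matrix.vecMulVec (c.eps H w) (c.eps H w) *
    ((sq (c.S H w))⁻¹)ᵀ * (sq c.extent)ᵀ

/-- The updated GGIW component for the cell `𝐰`, with weight `ω`. -/
def ExtComp.update {k nx d : ℕ} (c : ExtComp k nx d) (H : Matrix (Fin d) (Fin nx) ℝ)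
    (sq : Matrix (Fin d) (Fin d) ℝ → Matrix (Fin d) (Fin d) ℝ)
    (w : Finset (Meas d)) (ω : ℝ) : ExtComp k nx d where
  toGaussComp := c.kalman H (meanNoise w c.extent) (cellMean w) ω
  a := c.a + w.card
  b := c.b + 1
  v := c.v + w.card
  V := c.V + c.N H sq w + cellScatter w

/-- Likelihood `q_e(𝐰)`. -/
def ExtComp.q {k nx d : ℕ} (c : ExtComp k nx d) (H : Matrix (Fin d) (Fin nx) ℝ)
    (sq : Matrix (Fin d) (Fin d) ℝ → Matrix (Fin d) (Fin d) ℝ)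
    (w : Finset (Meas d)) : ℝ :=
  let c' := c.update H sq w 1
  (Real.pi ^ w.card * (w.card : ℝ)) ^ (-(d : ℝ) / 2) *
    (c.V.det ^ ((c.v - d - 1) / 2) / c'.V.det ^ ((c'.v - d - 1) / 2)) *
    ((multiGamma d ((c'.v - d - 1) / 2) * c.extent.det ^ ((1 : ℝ) / 2) *
        Real.Gamma c'.a * c.b ^ c.a) /
      (multiGamma d ((c.v - d - 1) / 2) * (c.S H w).det ^ ((1 : ℝ) / 2) *
        Real.Gamma c.a * c'.b ^ c'.a))

/-- Likelihood `q_p({z}) = 𝒩(z; H m_{[k]}, H P_{[k,k]} Hᵀ + R)`. -/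
def GaussComp.q {k nx d : ℕ} (c : GaussComp k nx) (M : Sensor nx d) (w : Finset (Meas d)) : ℝ :=
  gaussPDF (M.H *ᵥ c.meanK) (c.innovCov M.H M.R) (cellMean w)

section Posterior

variable {k nx d Jp Je : ℕ} (M : Sensor nx d)
  (sq : Matrix (Fin d) (Fin d) ℝ → Matrix (Fin d) (Fin d) ℝ)
  (pc : Fin Jp → GaussComp k nx) (ec : Fin Je → ExtComp k nx d)

/-- `d_𝐰`. -/
def cellFactor (w : Finset (Meas d)) : ℝ :=
  (if w.card = 1 then 1 else 0) +
    ∑ l, (ec l).weight * M.pD * ((ec l).q M.H sq w / ∏ z ∈ w, M.clutter z) +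
    ∑ o, (pc o).weight * M.pD * ((pc o).q M w / ∏ z ∈ w, M.clutter z) *
      (if w.card = 1 then 1 else 0)

/-- `ω_{e,j}(𝐰)` for a cell of the partition `P`. -/
def extWeight {z : Finset (Meas d)} (P : Finpartition z) (w : Finset (Meas d)) (j : Fin Je) : ℝ :=
  partWeight (cellFactor M sq pc ec) P / cellFactor M sq pc ec w * (ec j).weight * M.pD *
    ((ec j).q M.H sq w / ∏ z ∈ w, M.clutter z)

/-- `ω_{p,i}(𝐰)` for a cell of the partition `P`. -/
def pointWeight {z : Finset (Meas d)} (P : Finpartition z) (w : Finset (Meas d))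
    (i : Fin Jp) : ℝ :=
  partWeight (cellFactor M sq pc ec) P / cellFactor M sq pc ec w * (pc i).weight * M.pD *
    ((pc i).q M w / ∏ z ∈ w, M.clutter z) * (if w.card = 1 then 1 else 0)

/-- Updated extended-target components. -/
def extDetected {z : Finset (Meas d)} (P : Finpartition z) (w : Finset (Meas d))
    (j : Fin Je) : ExtComp k nx d :=
  (ec j).update M.H sq w (extWeight M sq pc ec P w j)

/-- Updated point-target components. -/
def pointDetected {z : Finset (Meas d)} (P : Finpartition z) (w : Finset (Meas d))
    (i : Fin Jp) : GaussComp k nx :=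
  (pc i).kalman M.H M.R (cellMean w) (pointWeight M sq pc ec P w i)

/-- The detected part `λ^D(X, 𝐰)`. -/
def detectedPHD {z : Finset (Meas d)} (P : Finpartition z) (w : Finset (Meas d)) :
    CoState k nx d → ℝ :=
  mixturePHD (pointDetected M sq pc ec P w) (extDetected M sq pc ec P w)

/-- The missed-detection part `λ^{ND}(X)`. -/
def missedPHD : CoState k nx d → ℝ
  | Sum.inl X => ∑ i, (1 - M.pD) * (pc i).weight * (pc i).density X
  | Sum.inr X => ∑ j, (ec j).weight * (ec j).density X.1 *
      invWishartPDF (ec j).v (ec j).V X.2.2.1 *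
      ((1 - M.pD) * ProbabilityTheory.gammaPDFReal (ec j).a (ec j).b X.2.1 +
        M.pD * ((ec j).b / ((ec j).b + 1)) ^ (ec j).a *
          ProbabilityTheory.gammaPDFReal (ec j).a ((ec j).b + 1) X.2.1)

end Posterior

end

end TPHD

open TPHD

/-! The exact statement rests on two pointwise identities. In
`∏_{z ∈ 𝐰} 𝒩(z; y, X̃)` the mean and the scatter of a cell separate (`prod_gaussPDF_cell`), and the
product of the likelihood of a linear measurement and a Gaussian prior factorises as in the Kalman
filter (`gaussPDF_mul_gaussPDF`, from Woodbury's identity and Sylvester's determinant identity).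
Together they turn `f λ` into the exact joint intensity.

The closed form of the posterior is a conjugacy argument. With the gain frozen, the only coupling
between the trajectory and the extent is through the innovation covariance; after the substitution
this is `T X̃ Tᵀ` with `T = S^{1/2} X̂^{-1/2}`, so that its determinant is a multiple of `|X̃|` and its
quadratic form is `tr(N X̃⁻¹)`. The Gaussian factor of the cell mean is then absorbed into the
inverse-Wishart factor (`ExtComp.invWishart_conjugacy`), the Poisson factor into the Gamma factor
(`poisson_mul_gammaPDFReal`), and the joint intensity of every nonempty cell is a mixture of
admissible components whose weights are the likelihoods `q` (`ggiwJoint_eq_mixturePHD`). As such a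
mixture integrates to the sum of its weights (`mixturePHD_integrable_integral`),
`κ_𝐰 + τ_𝐰 = d_𝐰 ∏_{z ∈ 𝐰} λ^C(z)`. The clutter factors multiply to the same number over the cells
of every partition, so they cancel in the weights of the partitions.

The analytic core is that the inverse-Wishart density integrates to one
(`invWishartPDF_integrable_integral`). On symmetric matrices in the coordinates on and above the
diagonal, the substitution `X = L Y⁻¹ Lᵀ` has derivative `-(H ↦ B H Bᵀ)` with `B = L Y⁻¹`, and the
determinant of `H ↦ B H Bᵀ` is `|B|^{d+1}` (`det_congruence`). Since `v > 2d + 2`, the exponent of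
the determinant in the resulting Gamma integral is positive, so the integrand is dominated by
`C e^{-tr Y / 2}`, which decays exponentially in all coordinates because the entries of a positive
semidefinite matrix are bounded by its trace. -/

namespace TPHD

/-! ### Positive definite matrices -/

theorem posSemidef_conj {ι κ : Type} [Fintype ι] [Fintype κ] {E : Matrix ι ι ℝ}
    (hE : E.PosSemidef) (C : Matrix κ ι ℝ) :
    (C * E * Cᵀ).PosSemidef := by
  have := hE.mul_mul_conjTranspose_same C
  rwa [Matrix.conjTranspose_eq_transpose_of_trivial] at this

theorem posSemidef_vecMulVec_self {ι : Type} [Fintype ι] (x : ι → ℝ) :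
    (Matrix.vecMulVec x x).PosSemidef := by
  simpa using Matrix.posSemidef_vecMulVec_self_star x

theorem transpose_eq_of_posDef {ι : Type} {E : Matrix ι ι ℝ} (hE : E.PosDef) : Eᵀ = E := by
  have := hE.isHermitian.eq
  rwa [Matrix.conjTranspose_eq_transpose_of_trivial] at this

theorem dotProduct_mulVec_eq_trace {ι : Type} [Fintype ι] (A : Matrix ι ι ℝ) (x : ι → ℝ) :
    x ⬝ᵥ (A *ᵥ x) = (Matrix.vecMulVec x x * A).trace := by
  rw [Matrix.vecMulVec_mul, Matrix.trace_vecMulVec, Matrix.dotProduct_mulVec, dotProduct_comm]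

theorem posDef_innovation {ι κ : Type} [Fintype ι] [Fintype κ]
    {P : Matrix ι ι ℝ} (hP : P.PosDef) {E : Matrix κ κ ℝ} (hE : E.PosDef)
    (C : Matrix κ ι ℝ) : (C * P * Cᵀ + E).PosDef :=
  Matrix.PosDef.posSemidef_add (posSemidef_conj hP.posSemidef C) hE

section LinearAlgebra

variable {ι κ : Type} [Fintype ι] [DecidableEq ι] [Fintype κ] [DecidableEq κ]

theorem posDef_mul_mul_transpose {E : Matrix ι ι ℝ} (hE : E.PosDef) {A : Matrix ι ι ℝ}
    (hA : IsUnit A) : (A * E * Aᵀ).PosDef := by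
  have h := (Matrix.IsUnit.posDef_star_right_conjugate_iff hA (x := E)).2 hE
  rwa [Matrix.star_eq_conjTranspose, Matrix.conjTranspose_eq_transpose_of_trivial] at h

theorem isUnit_of_mul_transpose_posDef {A E : Matrix ι ι ℝ} (hE : E.PosDef) (h : A * Aᵀ = E) :
    IsUnit A := by
  rw [Matrix.isUnit_iff_isUnit_det, isUnit_iff_ne_zero]
  intro h0
  have := hE.det_pos
  rw [← h, Matrix.det_mul, h0, zero_mul] at this
  exact this.false

theorem exists_mul_transpose_eq {E : Matrix ι ι ℝ} (hE : E.PosDef) :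
    ∃ A : Matrix ι ι ℝ, IsUnit A ∧ A * Aᵀ = E := by
  open scoped MatrixOrder in
  obtain ⟨B, hB⟩ := CStarAlgebra.nonneg_iff_eq_star_mul_self.mp hE.posSemidef.nonneg
  rw [Matrix.star_eq_conjTranspose, Matrix.conjTranspose_eq_transpose_of_trivial] at hB
  have h : Bᵀ * Bᵀᵀ = E := by rw [Matrix.transpose_transpose, ← hB]
  exact ⟨Bᵀ, isUnit_of_mul_transpose_posDef hE h, h⟩

/-- Woodbury's identity: the posterior precision is the sum of the precision of the prior and of
the precision of the measurement. -/
theorem kalman_cov_eq_inv {P : Matrix ι ι ℝ} (hP : P.PosDef) {E : Matrix κ κ ℝ} (hE : E.PosDef)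
    (C : Matrix κ ι ℝ) :
    P - P * Cᵀ * (C * P * Cᵀ + E)⁻¹ * C * P = (P⁻¹ + Cᵀ * E⁻¹ * C)⁻¹ := by
  have hS := posDef_innovation hP hE C
  have hPu := hP.isUnit
  have hEu := hE.isUnit
  have e1 : (P⁻¹)⁻¹ = P := Matrix.nonsing_inv_nonsing_inv _ ((Matrix.isUnit_iff_isUnit_det _).1 hPu)
  have e2 : (E⁻¹)⁻¹ = E := Matrix.nonsing_inv_nonsing_inv _ ((Matrix.isUnit_iff_isUnit_det _).1 hEu)
  rw [Matrix.add_mul_mul_inv_eq_sub _ _ _ _ hP.inv.isUnit hE.inv.isUnit, e1, e2,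
    add_comm E]
  rw [e1, e2, add_comm E]
  exact hS.isUnit

theorem posDef_precision {P : Matrix ι ι ℝ} (hP : P.PosDef) {E : Matrix κ κ ℝ} (hE : E.PosDef)
    (C : Matrix κ ι ℝ) : (P⁻¹ + Cᵀ * E⁻¹ * C).PosDef := by
  refine hP.inv.add_posSemidef ?_
  simpa using posSemidef_conj hE.inv.posSemidef Cᵀ

theorem posDef_kalman_cov {P : Matrix ι ι ℝ} (hP : P.PosDef) {E : Matrix κ κ ℝ} (hE : E.PosDef)
    (C : Matrix κ ι ℝ) : (P - P * Cᵀ * (C * P * Cᵀ + E)⁻¹ * C * P).PosDef := by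
  rw [kalman_cov_eq_inv hP hE]
  exact (posDef_precision hP hE C).inv

/-- The determinant part of the Kalman factorisation, from Woodbury's identity and Sylvester's
`|1 + A B| = |1 + B A|`. -/
theorem det_kalman {P : Matrix ι ι ℝ} (hP : P.PosDef) {E : Matrix κ κ ℝ} (hE : E.PosDef)
    (C : Matrix κ ι ℝ) :
    (C * P * Cᵀ + E).det * (P - P * Cᵀ * (C * P * Cᵀ + E)⁻¹ * C * P).det = E.det * P.det := by
  have hPd := (Matrix.isUnit_iff_isUnit_det _).1 hP.isUnit
  have hEd := (Matrix.isUnit_iff_isUnit_det _).1 hE.isUnit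
  rw [kalman_cov_eq_inv hP hE, Matrix.det_nonsing_inv, Ring.inverse_eq_inv']
  have h1 : (P⁻¹ + Cᵀ * E⁻¹ * C).det * P.det = (1 + E⁻¹ * C * P * Cᵀ).det := by
    rw [← Matrix.det_mul, add_mul, Matrix.nonsing_inv_mul _ hPd]
    have : Cᵀ * E⁻¹ * C * P = Cᵀ * (E⁻¹ * C * P) := by simp only [Matrix.mul_assoc]
    rw [this, Matrix.det_one_add_mul_comm]
  have h2 : (1 + E⁻¹ * C * P * Cᵀ).det * E.det = (C * P * Cᵀ + E).det := by
    rw [mul_comm, ← Matrix.det_mul, mul_add, mul_one, add_comm]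
    congr 2
    simp only [← Matrix.mul_assoc]
    rw [Matrix.mul_nonsing_inv _ hEd, Matrix.one_mul]
  have h3 := (posDef_precision hP hE C).det_pos.ne'
  rw [← h2, ← h1]
  field_simp

/-- The exponent part of the Kalman factorisation: completing the square in `e` for the sum of the
quadratic forms of the likelihood and of the prior. Here `u` is the innovation and `e` the deviation
from the prior mean. -/
theorem quadratic_kalman {P : Matrix ι ι ℝ} (hP : P.PosDef) {E : Matrix κ κ ℝ} (hE : E.PosDef)
    (C : Matrix κ ι ℝ) (e : ι → ℝ) (u : κ → ℝ) :
    (u - C *ᵥ e) ⬝ᵥ (E⁻¹ *ᵥ (u - C *ᵥ e)) + e ⬝ᵥ (P⁻¹ *ᵥ e) =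
      u ⬝ᵥ ((C * P * Cᵀ + E)⁻¹ *ᵥ u) +
        (e - (P * Cᵀ * (C * P * Cᵀ + E)⁻¹) *ᵥ u) ⬝ᵥ
          ((P - P * Cᵀ * (C * P * Cᵀ + E)⁻¹ * C * P)⁻¹ *ᵥ
            (e - (P * Cᵀ * (C * P * Cᵀ + E)⁻¹) *ᵥ u)) := by
  have hPd := (Matrix.isUnit_iff_isUnit_det _).1 hP.isUnit
  have hEd := (Matrix.isUnit_iff_isUnit_det _).1 hE.isUnit
  have hS := posDef_innovation hP hE C
  have hSd := (Matrix.isUnit_iff_isUnit_det _).1 hS.isUnit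
  have hQd := (Matrix.isUnit_iff_isUnit_det _).1 (posDef_precision hP hE C).isUnit
  have hQt := transpose_eq_of_posDef (posDef_precision hP hE C)
  have hEt := transpose_eq_of_posDef hE.inv
  rw [kalman_cov_eq_inv hP hE, Matrix.nonsing_inv_nonsing_inv _ hQd]
  set S := C * P * Cᵀ + E with hSdef
  set Q := P⁻¹ + Cᵀ * E⁻¹ * C with hQdef
  set K := P * Cᵀ * S⁻¹ with hK
  -- the precision form of the gain, `K = Q⁻¹ Cᵀ E⁻¹`
  have hQK : Q * K = Cᵀ * E⁻¹ := by
    have : Q * (P * Cᵀ) = Cᵀ * E⁻¹ * S := by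
      rw [hQdef, hSdef, Matrix.add_mul, Matrix.mul_add, ← Matrix.mul_assoc P⁻¹, Matrix.nonsing_inv_mul _ hPd,
        Matrix.mul_assoc Cᵀ E⁻¹ E, Matrix.nonsing_inv_mul _ hEd, Matrix.one_mul, Matrix.mul_one,
        add_comm]
      simp only [Matrix.mul_assoc]
    rw [hK, ← Matrix.mul_assoc, this, Matrix.mul_assoc, Matrix.mul_nonsing_inv _ hSd,
      Matrix.mul_one]
  have hEinv : E⁻¹ = S⁻¹ + E⁻¹ * C * K := by
    have : E⁻¹ * S * S⁻¹ = (E⁻¹ * (C * P * Cᵀ) + 1) * S⁻¹ := by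
      conv_lhs => rw [hSdef, mul_add, Matrix.nonsing_inv_mul _ hEd, ← hSdef]
    rw [Matrix.mul_assoc, Matrix.mul_nonsing_inv _ hSd, Matrix.mul_one, add_mul, one_mul,
      add_comm] at this
    conv_lhs => rw [this]
    rw [hK]
    simp only [Matrix.mul_assoc]
  have hq : ∀ x y : ι → ℝ, x ⬝ᵥ Q *ᵥ y = y ⬝ᵥ Q *ᵥ x := fun x y => by
    conv_lhs => rw [Matrix.dotProduct_mulVec, ← Matrix.mulVec_transpose, hQt, dotProduct_comm]
  have hs : ∀ x y : κ → ℝ, x ⬝ᵥ E⁻¹ *ᵥ y = y ⬝ᵥ E⁻¹ *ᵥ x := fun x y => by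
    conv_lhs => rw [Matrix.dotProduct_mulVec, ← Matrix.mulVec_transpose, hEt, dotProduct_comm]
  have hC : ∀ (x : ι → ℝ) (y : κ → ℝ), x ⬝ᵥ (Cᵀ *ᵥ y) = (C *ᵥ x) ⬝ᵥ y := fun x y => by
    rw [Matrix.dotProduct_mulVec, Matrix.vecMul_transpose]
  have t1 : e ⬝ᵥ Q *ᵥ (K *ᵥ u) = (C *ᵥ e) ⬝ᵥ (E⁻¹ *ᵥ u) := by
    rw [Matrix.mulVec_mulVec, hQK, ← Matrix.mulVec_mulVec, hC]
  have t2 : (K *ᵥ u) ⬝ᵥ Q *ᵥ (K *ᵥ u) = u ⬝ᵥ ((E⁻¹ * C * K) *ᵥ u) := by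
    rw [Matrix.mulVec_mulVec u Q K, hQK, ← Matrix.mulVec_mulVec u Cᵀ, hC, hs]
    simp only [Matrix.mulVec_mulVec, Matrix.mul_assoc]
  have t3 : u ⬝ᵥ (E⁻¹ *ᵥ u) = u ⬝ᵥ (S⁻¹ *ᵥ u) + u ⬝ᵥ ((E⁻¹ * C * K) *ᵥ u) := by
    conv_lhs => rw [hEinv]
    rw [Matrix.add_mulVec, dotProduct_add]
  have t4 : e ⬝ᵥ Q *ᵥ e = e ⬝ᵥ P⁻¹ *ᵥ e + (C *ᵥ e) ⬝ᵥ (E⁻¹ *ᵥ (C *ᵥ e)) := by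
    rw [hQdef, Matrix.add_mulVec, dotProduct_add, ← Matrix.mulVec_mulVec, ← Matrix.mulVec_mulVec,
      hC]
  simp only [Matrix.mulVec_sub, sub_dotProduct, dotProduct_sub]
  rw [hq (K *ᵥ u) e, t1, t2, t3, t4, hs u (C *ᵥ e)]
  ring

end LinearAlgebra

/-! ### Gaussian densities -/

section Gaussian

variable {ι κ : Type} [Fintype ι] [DecidableEq ι] [Fintype κ] [DecidableEq κ]

theorem gaussPDF_nonneg (m : ι → ℝ) {P : Matrix ι ι ℝ} (hP : P.PosDef) (x : ι → ℝ) :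
    0 ≤ gaussPDF m P x := by
  have := hP.det_pos
  unfold gaussPDF
  positivity

/-- The Kalman factorisation of the product of the likelihood of a linear measurement and a
Gaussian prior. -/
theorem gaussPDF_mul_gaussPDF {P : Matrix ι ι ℝ} (hP : P.PosDef) {E : Matrix κ κ ℝ}
    (hE : E.PosDef) (C : Matrix κ ι ℝ) (m x : ι → ℝ) (y : κ → ℝ) :
    gaussPDF (C *ᵥ x) E y * gaussPDF m P x =
      gaussPDF (C *ᵥ m) (C * P * Cᵀ + E) y *
        gaussPDF (m + (P * Cᵀ * (C * P * Cᵀ + E)⁻¹) *ᵥ (y - C *ᵥ m))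
          (P - P * Cᵀ * (C * P * Cᵀ + E)⁻¹ * C * P) x := by
  have hq := quadratic_kalman hP hE C (x - m) (y - C *ᵥ m)
  have hd := det_kalman hP hE C
  have h1 := hP.det_pos
  have h2 := hE.det_pos
  have h3 := (posDef_innovation hP hE C).det_pos
  have h4 := (posDef_kalman_cov hP hE C).det_pos
  have e1 : y - C *ᵥ x = y - C *ᵥ m - C *ᵥ (x - m) := by
    rw [Matrix.mulVec_sub]; abel
  have e2 : ∀ v : ι → ℝ, x - (m + v) = x - m - v := fun v => by abel
  unfold gaussPDF
  rw [e1, e2]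
  have hd' : (C * P * Cᵀ + E).det ^ (-(1 : ℝ) / 2) *
      (P - P * Cᵀ * (C * P * Cᵀ + E)⁻¹ * C * P).det ^ (-(1 : ℝ) / 2) =
      E.det ^ (-(1 : ℝ) / 2) * P.det ^ (-(1 : ℝ) / 2) := by
    rw [← Real.mul_rpow h3.le h4.le, hd, Real.mul_rpow h2.le h1.le]
  have he := congrArg (fun t => Real.exp (-(1 / 2) * t)) hq
  simp only [mul_add, Real.exp_add] at he
  linear_combination (2 * Real.pi) ^ (-(Fintype.card κ : ℝ) / 2) *
    (2 * Real.pi) ^ (-(Fintype.card ι : ℝ) / 2) *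
    (E.det ^ (-(1 : ℝ) / 2) * P.det ^ (-(1 : ℝ) / 2) * he -
      hd' * (Real.exp (-(1 / 2) * ((y - C *ᵥ m) ⬝ᵥ (C * P * Cᵀ + E)⁻¹ *ᵥ (y - C *ᵥ m))) *
        Real.exp (-(1 / 2) * ((x - m - (P * Cᵀ * (C * P * Cᵀ + E)⁻¹) *ᵥ (y - C *ᵥ m)) ⬝ᵥ
          (P - P * Cᵀ * (C * P * Cᵀ + E)⁻¹ * C * P)⁻¹ *ᵥ
            (x - m - (P * Cᵀ * (C * P * Cᵀ + E)⁻¹) *ᵥ (y - C *ᵥ m))))))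

/-- The Gaussian density is proper: with `P = L Lᵀ`, the substitution `x = m + L y` reduces it to a
product of one-dimensional standard Gaussians. -/
theorem gaussPDF_integrable_integral (m : ι → ℝ) {P : Matrix ι ι ℝ} (hP : P.PosDef) :
    Integrable (gaussPDF m P) ∧ ∫ x, gaussPDF m P x = 1 := by
  obtain ⟨L, hL, hLP⟩ := exists_mul_transpose_eq hP
  have hLd := (Matrix.isUnit_iff_isUnit_det _).1 hL
  have hL0 : L.det ≠ 0 := hLd.ne_zero
  let A : (ι → ℝ) →L[ℝ] (ι → ℝ) := LinearMap.toContinuousLinearMap (Matrix.toLin' L)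
  have hAapp : ∀ y, A y = L *ᵥ y := fun y => rfl
  have hAdet : A.det = L.det := by simp [A, ContinuousLinearMap.det]
  let f : (ι → ℝ) → (ι → ℝ) := fun y => m + A y
  have hf' : ∀ y ∈ (Set.univ : Set (ι → ℝ)), HasFDerivWithinAt f A Set.univ y := fun y _ =>
    (A.hasFDerivAt.const_add m).hasFDerivWithinAt
  have hinv : ∀ y, L⁻¹ *ᵥ (A y) = y := fun y => by
    rw [hAapp, Matrix.mulVec_mulVec, Matrix.nonsing_inv_mul _ hLd, Matrix.one_mulVec]
  have hinj : Function.Injective f := fun x y h => by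
    have := add_left_cancel h
    rw [← hinv x, this, hinv]
  have hsurj : f '' Set.univ = Set.univ := by
    rw [Set.image_univ, Set.range_eq_univ]
    intro x
    refine ⟨L⁻¹ *ᵥ (x - m), ?_⟩
    simp only [f, hAapp, Matrix.mulVec_mulVec, Matrix.mul_nonsing_inv _ hLd, Matrix.one_mulVec]
    abel
  have hPi : P⁻¹ = (L⁻¹)ᵀ * L⁻¹ := by
    rw [← hLP, Matrix.mul_inv_rev, Matrix.transpose_nonsing_inv]
  have hPd : P.det ^ (-(1 : ℝ) / 2) = |L.det|⁻¹ := by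
    rw [← hLP, Matrix.det_mul, Matrix.det_transpose, ← abs_mul_abs_self,
      Real.mul_rpow (abs_nonneg _) (abs_nonneg _), ← Real.rpow_add (abs_pos.2 hL0)]
    norm_num
    exact Real.rpow_neg_one _
  have hval : ∀ y, |A.det| • gaussPDF m P (f y) =
      ∏ i, ((2 * Real.pi) ^ (-(1 : ℝ) / 2) * Real.exp (-(1 / 2) * y i ^ 2)) := fun y => by
    have hq : (f y - m) ⬝ᵥ (P⁻¹ *ᵥ (f y - m)) = ∑ i, y i ^ 2 := by
      simp only [f, add_sub_cancel_left]
      rw [hPi, ← Matrix.mulVec_mulVec, hinv, Matrix.dotProduct_mulVec, Matrix.vecMul_transpose,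
        hinv]
      simp [dotProduct, sq]
    rw [Finset.prod_mul_distrib, ← Real.exp_sum, ← Finset.mul_sum, ← hq, Finset.prod_const,
      Finset.card_univ, ← Real.rpow_mul_natCast (by positivity), hAdet, gaussPDF, hPd, smul_eq_mul]
    have : |L.det| ≠ 0 := abs_ne_zero.2 hL0
    field_simp
  constructor
  · rw [← integrableOn_univ, ← hsurj,
      integrableOn_image_iff_integrableOn_abs_det_fderiv_smul volume MeasurableSet.univ hf'
        hinj.injOn, integrableOn_univ]
    simp only [hval]
    exact Integrable.fintype_prod fun i =>
      (integrable_exp_neg_mul_sq (by norm_num : (0 : ℝ) < 1 / 2)).const_mul _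
  · rw [← setIntegral_univ, ← hsurj,
      integral_image_eq_integral_abs_det_fderiv_smul volume MeasurableSet.univ hf' hinj.injOn,
      setIntegral_univ]
    simp only [hval]
    rw [integral_fintype_prod_volume_eq_prod
      (fun (_ : ι) (t : ℝ) => (2 * Real.pi) ^ (-(1 : ℝ) / 2) * Real.exp (-(1 / 2) * t ^ 2))]
    refine Finset.prod_eq_one fun i _ => ?_
    rw [integral_const_mul, integral_gaussian, Real.sqrt_eq_rpow,
      show Real.pi / (1 / 2) = 2 * Real.pi by ring, ← Real.rpow_add (by positivity)]
    norm_num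

end Gaussian

/-! ### Congruence transformations of symmetric matrices -/

section Congruence

variable {d : ℕ}

/-- The index set of the coordinates of a symmetric matrix on or above the diagonal. -/
abbrev UpperIdx (d : ℕ) : Type := {p : Fin d × Fin d // p.1 ≤ p.2}

/-- The symmetric matrix with given coordinates on and above the diagonal. -/
def symMat (d : ℕ) : (UpperIdx d → ℝ) →ₗ[ℝ] Matrix (Fin d) (Fin d) ℝ where
  toFun u := Matrix.of fun i j => if h : i ≤ j then u ⟨(i, j), h⟩ else u ⟨(j, i), le_of_not_ge h⟩
  map_add' u v := by ext i j; simp only [Matrix.of_apply, Matrix.add_apply]; split_ifs <;> rfl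
  map_smul' c u := by ext i j; simp only [Matrix.of_apply, Matrix.smul_apply]; split_ifs <;> rfl

/-- The coordinates of a matrix on and above the diagonal. -/
def upperLin (d : ℕ) : Matrix (Fin d) (Fin d) ℝ →ₗ[ℝ] (UpperIdx d → ℝ) where
  toFun M := fun p => M p.1.1 p.1.2
  map_add' _ _ := rfl
  map_smul' _ _ := rfl

theorem upperLin_apply (M : Matrix (Fin d) (Fin d) ℝ) (p : UpperIdx d) :
    upperLin d M p = M p.1.1 p.1.2 := rfl

theorem symMat_apply (u : UpperIdx d → ℝ) (i j : Fin d) :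
    symMat d u i j = if h : i ≤ j then u ⟨(i, j), h⟩ else u ⟨(j, i), le_of_not_ge h⟩ := rfl

theorem transpose_symMat (u : UpperIdx d → ℝ) : (symMat d u)ᵀ = symMat d u := by
  ext i j
  rw [Matrix.transpose_apply, symMat_apply, symMat_apply]
  rcases lt_trichotomy i j with h | rfl | h
  · rw [dif_neg h.not_ge, dif_pos h.le]
  · rfl
  · rw [dif_pos h.le, dif_neg h.not_ge]

theorem upperLin_symMat (u : UpperIdx d → ℝ) : upperLin d (symMat d u) = u := by
  ext p
  rw [upperLin_apply, symMat_apply, dif_pos p.2]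

theorem symMat_upperLin {M : Matrix (Fin d) (Fin d) ℝ} (hM : Mᵀ = M) :
    symMat d (upperLin d M) = M := by
  ext i j
  rw [symMat_apply]
  split_ifs
  · rfl
  · exact congrFun (congrFun hM i) j

/-- The congruence `X ↦ B X Bᵀ` on symmetric matrices, in the coordinates on and above the
diagonal. -/
def congruence (B : Matrix (Fin d) (Fin d) ℝ) : (UpperIdx d → ℝ) →ₗ[ℝ] (UpperIdx d → ℝ) :=
  upperLin d ∘ₗ LinearMap.mulRight ℝ Bᵀ ∘ₗ LinearMap.mulLeft ℝ B ∘ₗ symMat d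

theorem congruence_apply (B : Matrix (Fin d) (Fin d) ℝ) (u : UpperIdx d → ℝ) :
    congruence B u = upperLin d (B * symMat d u * Bᵀ) := rfl

theorem congruence_mul (A B : Matrix (Fin d) (Fin d) ℝ) :
    congruence (A * B) = congruence A * congruence B := by
  refine LinearMap.ext fun u => ?_
  rw [Module.End.mul_apply, congruence_apply, congruence_apply, congruence_apply, symMat_upperLin]
  · simp only [Matrix.transpose_mul, Matrix.mul_assoc]
  · simp only [Matrix.transpose_mul, Matrix.transpose_transpose, transpose_symMat,
      Matrix.mul_assoc]

theorem congruence_one : congruence (1 : Matrix (Fin d) (Fin d) ℝ) = 1 := by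
  refine LinearMap.ext fun u => ?_
  rw [congruence_apply, Matrix.transpose_one, Matrix.one_mul, Matrix.mul_one, upperLin_symMat]
  rfl

/-- Each `D i` occurs `d + 1` times: once for each index, and once more because both factors of the
diagonal term are `D i`. -/
theorem prod_upperIdx (D : Fin d → ℝ) :
    ∏ p : UpperIdx d, D p.1.1 * D p.1.2 = (∏ i, D i) ^ (d + 1) := by
  have h1 : ∀ f : Fin d → Fin d → ℝ,
      ∏ p : UpperIdx d, f p.1.1 p.1.2 = ∏ i, ∏ j, if i ≤ j then f i j else 1 := fun f => by
    rw [← Fintype.prod_prod_type', ← Finset.prod_filter]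
    exact (Finset.prod_subtype _ (fun x => by simp) (fun p : Fin d × Fin d => f p.1 p.2)).symm
  rw [Finset.prod_mul_distrib, h1 (fun i _ => D i), h1 (fun _ j => D j),
    Finset.prod_comm (f := fun i j => if i ≤ j then D j else 1), ← Finset.prod_mul_distrib]
  have h2 : ∀ i : Fin d, ((∏ j, if i ≤ j then D i else 1) * ∏ j, if j ≤ i then D i else 1) =
      D i ^ (d + 1) := fun i => by
    rw [← Finset.prod_mul_distrib]
    have : ∀ j : Fin d, ((if i ≤ j then D i else 1) * if j ≤ i then D i else 1) =
        D i * if j = i then D i else 1 := fun j => by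
      rcases lt_trichotomy i j with h | rfl | h
      · simp [h.le, h.not_ge, h.ne']
      · simp
      · simp [h.le, h.not_ge, h.ne]
    simp only [this]
    rw [Finset.prod_mul_distrib, Finset.prod_const, Finset.card_univ, Fintype.card_fin,
      Finset.prod_ite_eq' Finset.univ i (fun _ => D i), if_pos (Finset.mem_univ i), pow_succ]
  simp only [h2, Finset.prod_pow]

theorem det_congruence_diagonal (D : Fin d → ℝ) :
    LinearMap.det (congruence (Matrix.diagonal D)) = (Matrix.diagonal D).det ^ (d + 1) := by
  have h : congruence (Matrix.diagonal D) =
      Matrix.toLin' (Matrix.diagonal fun p : UpperIdx d => D p.1.1 * D p.1.2) := by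
    refine LinearMap.ext fun u => funext fun p => ?_
    rw [congruence_apply, upperLin_apply, Matrix.diagonal_transpose, Matrix.mul_diagonal,
      Matrix.diagonal_mul, ← upperLin_apply (symMat d u), upperLin_symMat, Matrix.toLin'_apply,
      Matrix.mulVec_diagonal]
    ring
  rw [h, LinearMap.det_toLin', Matrix.det_diagonal, Matrix.det_diagonal, prod_upperIdx]

/-- A transvection `T(c)` satisfies both `T(2c) = T(c)²` and, being conjugate to it by a diagonal
matrix, `T(2c) ∼ T(c)`; so every multiplicative function of it is trivial. -/
theorem det_congruence_transvection (t : Matrix.TransvectionStruct (Fin d) ℝ) :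
    LinearMap.det (congruence t.toMatrix) = 1 := by
  obtain ⟨i, j, hij, c⟩ := t
  change LinearMap.det (congruence (Matrix.transvection i j c)) = 1
  have hadd : ∀ a b : ℝ, LinearMap.det (congruence (Matrix.transvection i j (a + b))) =
      LinearMap.det (congruence (Matrix.transvection i j a)) *
        LinearMap.det (congruence (Matrix.transvection i j b)) := fun a b => by
    rw [← Matrix.transvection_mul_transvection_same i j hij, congruence_mul, map_mul]
  set D : Fin d → ℝ := Function.update 1 i 2 with hD
  have hDi : D i = 2 := by simp [hD]
  have hDj : D j = 1 := by simp [hD, hij.symm]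
  -- rescaling the `i`-th coordinate by `2` conjugates `T(c)` to `T(2c)`
  have hconj : Matrix.diagonal D * Matrix.transvection i j c =
      Matrix.transvection i j (c + c) * Matrix.diagonal D := by
    rw [Matrix.transvection, Matrix.transvection, mul_add, add_mul, mul_one, one_mul]
    congr 1
    ext a b
    rw [Matrix.diagonal_mul, Matrix.mul_diagonal, Matrix.single_apply, Matrix.single_apply]
    split_ifs with h
    · rw [← h.1, ← h.2, hDi, hDj]; ring
    · simp
  have h := congrArg (fun A => LinearMap.det (congruence A)) hconj
  simp only [congruence_mul, map_mul, hadd, det_congruence_diagonal] at h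
  have hD0 : (Matrix.diagonal D).det ^ (d + 1) ≠ 0 := by
    refine pow_ne_zero _ ?_
    rw [Matrix.det_diagonal]
    refine Finset.prod_ne_zero_iff.2 fun l _ => ?_
    by_cases hl : l = i
    · rw [hl, hDi]; norm_num
    · simp [hD, hl]
  have hT0 : LinearMap.det (congruence (Matrix.transvection i j c)) ≠ 0 := fun h0 => by
    have := hadd c (-c)
    rw [h0, zero_mul, add_neg_cancel, Matrix.transvection_zero, congruence_one, map_one] at this
    exact one_ne_zero this
  have h' : (Matrix.diagonal D).det ^ (d + 1) *
      LinearMap.det (congruence (Matrix.transvection i j c)) *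
        (LinearMap.det (congruence (Matrix.transvection i j c)) - 1) = 0 := by
    linear_combination -h
  rcases mul_eq_zero.1 h' with h' | h'
  · exact absurd h' (mul_ne_zero hD0 hT0)
  · linarith

/-- The Jacobian of `X ↦ B X Bᵀ` on symmetric `d × d` matrices is `|B|^{d+1}`. -/
theorem det_congruence {B : Matrix (Fin d) (Fin d) ℝ} (hB : B.det ≠ 0) :
    LinearMap.det (congruence B) = B.det ^ (d + 1) := by
  refine Matrix.diagonal_transvection_induction_of_det_ne_zero
    (fun B => LinearMap.det (congruence B) = B.det ^ (d + 1)) B hB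
    (fun D _ => det_congruence_diagonal D) (fun t => ?_) fun A B _ _ hA hB => ?_
  · rw [det_congruence_transvection, Matrix.TransvectionStruct.det, one_pow]
  · rw [congruence_mul, map_mul, hA, hB, Matrix.det_mul, mul_pow]

end Congruence

/-! ### The cone of positive definite matrices -/

section Cone

variable {d : ℕ}

/-- The cone of positive definite matrices in the coordinates on and above the diagonal. -/
def pdCone (d : ℕ) : Set (UpperIdx d → ℝ) := {u | (symMat d u).PosDef}

theorem symMat_upperCoord (M : PDMat d) : symMat d (upperCoord M) = M.1 :=
  symMat_upperLin (transpose_eq_of_posDef M.2)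

theorem upperCoord_injective : Function.Injective (upperCoord (d := d)) := fun M N h =>
  Subtype.ext (by rw [← symMat_upperCoord M, h, symMat_upperCoord])

theorem range_upperCoord : Set.range (upperCoord (d := d)) = pdCone d := by
  ext u
  constructor
  · rintro ⟨M, rfl⟩
    rw [pdCone, Set.mem_ofPred_eq, symMat_upperCoord]
    exact M.2
  · exact fun hu => ⟨⟨symMat d u, hu⟩, upperLin_symMat u⟩

theorem continuous_symMat : Continuous (symMat d) := (symMat d).continuous_of_finiteDimensional

theorem measurableSet_pdCone : MeasurableSet (pdCone d) := by
  have h : pdCone d = (⋂ x : Fin d → ℝ, {u | 0 ≤ x ⬝ᵥ (symMat d u *ᵥ x)}) ∩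
      {u | (symMat d u).det ≠ 0} := by
    ext u
    simp only [pdCone, Set.mem_ofPred_eq, Set.mem_inter_iff, Set.mem_iInter]
    constructor
    · exact fun hu => ⟨fun x => by simpa using hu.posSemidef.dotProduct_mulVec_nonneg x,
        hu.det_pos.ne'⟩
    · rintro ⟨h1, h2⟩
      have hs : (symMat d u).PosSemidef := by
        refine Matrix.PosSemidef.of_dotProduct_mulVec_nonneg ?_ fun x => by simpa using h1 x
        rw [Matrix.IsHermitian, Matrix.conjTranspose_eq_transpose_of_trivial, transpose_symMat]
      exact hs.posDef_iff_det_ne_zero.2 h2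
  rw [h]
  have hc := continuous_symMat (d := d)
  refine (isClosed_iInter fun x => isClosed_le continuous_const ?_).measurableSet.inter
    (isOpen_ne_fun ?_ continuous_const).measurableSet
  · fun_prop
  · fun_prop

theorem measurableEmbedding_upperCoord : MeasurableEmbedding (upperCoord (d := d)) where
  injective := upperCoord_injective
  measurable := comap_measurable _
  measurableSet_image' := by
    rintro _ ⟨t, ht, rfl⟩
    rw [Set.image_preimage_eq_inter_range, range_upperCoord]
    exact ht.inter measurableSet_pdCone

theorem map_upperCoord_pdVolume :
    (pdVolume d).map upperCoord = (volume : Measure (UpperIdx d → ℝ)).restrict (pdCone d) := by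
  rw [pdVolume, measurableEmbedding_upperCoord.map_comap, range_upperCoord]

instance instSigmaFinitePdVolume (d : ℕ) : SigmaFinite (pdVolume d) :=
  SigmaFinite.of_map _ measurableEmbedding_upperCoord.measurable.aemeasurable
    (by rw [map_upperCoord_pdVolume]; infer_instance)

theorem integral_pdVolume (f : Matrix (Fin d) (Fin d) ℝ → ℝ) :
    ∫ X : PDMat d, f X.1 ∂pdVolume d = ∫ u in pdCone d, f (symMat d u) := by
  rw [← map_upperCoord_pdVolume, measurableEmbedding_upperCoord.integral_map]
  simp only [symMat_upperCoord]

theorem integrable_pdVolume_iff (f : Matrix (Fin d) (Fin d) ℝ → ℝ) :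
    Integrable (fun X : PDMat d => f X.1) (pdVolume d) ↔
      IntegrableOn (fun u => f (symMat d u)) (pdCone d) := by
  rw [IntegrableOn, ← map_upperCoord_pdVolume, measurableEmbedding_upperCoord.integrable_map_iff]
  simp only [Function.comp_def, symMat_upperCoord]

/-- Positivity of the quadratic form at `e_i ± e_j` gives `2 |M_{ij}| ≤ M_{ii} + M_{jj}`. -/
theorem abs_apply_le_trace {M : Matrix (Fin d) (Fin d) ℝ} (hM : M.PosSemidef) (i j : Fin d) :
    |M i j| ≤ M.trace := by
  have hdiag : ∀ l, 0 ≤ M l l := fun l => hM.diag_nonneg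
  have hle : ∀ l, M l l ≤ M.trace := fun l =>
    Finset.single_le_sum (f := fun l => M l l) (fun l _ => hdiag l) (Finset.mem_univ l)
  have hsymm : M j i = M i j := by
    have := congrFun (congrFun hM.isHermitian.eq i) j
    simpa using this
  have hq : ∀ s : ℝ, 0 ≤ M i i + s * (2 * M i j) + s ^ 2 * M j j := fun s => by
    have := hM.dotProduct_mulVec_nonneg (Pi.single i 1 + s • Pi.single j 1)
    simp only [star_trivial, Matrix.mulVec_add, Matrix.mulVec_smul, add_dotProduct,
      smul_dotProduct, dotProduct_add, dotProduct_smul, Matrix.mulVec_single_one,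
      single_one_dotProduct, Matrix.col_apply, smul_eq_mul, hsymm] at this
    linarith
  have h1 := hq 1
  have h2 := hq (-1)
  rw [abs_le]
  constructor <;> linarith [hle i, hle j]

theorem det_le_trace_pow {M : Matrix (Fin d) (Fin d) ℝ} (hM : M.PosSemidef) :
    M.det ≤ M.trace ^ d := by
  have h1 := hM.isHermitian.det_eq_prod_eigenvalues
  have h2 := hM.isHermitian.trace_eq_sum_eigenvalues
  simp only [RCLike.ofReal_real_eq_id, id] at h1 h2
  rw [h1, h2]
  calc ∏ i, hM.isHermitian.eigenvalues i
      ≤ ∏ _i : Fin d, ∑ l, hM.isHermitian.eigenvalues l :=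
        Finset.prod_le_prod (fun i _ => hM.eigenvalues_nonneg i) fun i _ =>
          Finset.single_le_sum (fun l _ => hM.eigenvalues_nonneg l) (Finset.mem_univ i)
    _ = _ := by simp

theorem exists_rpow_le_exp {p : ℝ} (hp : 0 ≤ p) :
    ∃ C : ℝ, ∀ x : ℝ, 0 ≤ x → x ^ p ≤ C * Real.exp (x / 2) := by
  obtain ⟨N, hN⟩ := exists_nat_ge p
  refine ⟨1 + N.factorial * 2 ^ N, fun x hx => ?_⟩
  have h1 : x ^ p ≤ 1 + x ^ N := by
    rcases le_total x 1 with h | h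
    · have := Real.rpow_le_one hx h hp
      have : 0 ≤ x ^ N := by positivity
      linarith
    · have := Real.rpow_le_rpow_of_exponent_le h hN
      rw [Real.rpow_natCast] at this
      linarith
  have h2 : x ^ N ≤ N.factorial * 2 ^ N * Real.exp (x / 2) := by
    have := Real.pow_div_factorial_le_exp (x / 2) (by positivity) N
    rw [div_pow, div_div, div_le_iff₀ (by positivity)] at this
    linarith
  have h3 : 1 ≤ Real.exp (x / 2) := Real.one_le_exp (by positivity)
  linarith

theorem integrable_exp_neg_mul_abs {c : ℝ} (hc : 0 < c) :
    Integrable fun x : ℝ => Real.exp (-(c * |x|)) := by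
  rw [← integrableOn_univ, ← Set.Iic_union_Ioi (a := (0 : ℝ)), integrableOn_union]
  constructor
  · refine (integrableOn_exp_mul_Iic hc 0).congr_fun (fun x hx => ?_) measurableSet_Iic
    simp only [abs_of_nonpos (Set.mem_Iic.1 hx), mul_neg, neg_neg]
  · refine (integrableOn_exp_mul_Ioi (neg_lt_zero.2 hc) 0).congr_fun (fun x hx => ?_)
      measurableSet_Ioi
    simp only [abs_of_pos (Set.mem_Ioi.1 hx), neg_mul]

/-- The integral defining the multivariate Gamma function converges in the range of parameters
where the integrand is bounded at the boundary of the cone. -/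
theorem integrableOn_det_rpow_mul_exp {s : ℝ} (hs : 0 ≤ s) :
    IntegrableOn (fun u => (symMat d u).det ^ s * Real.exp (-(symMat d u).trace)) (pdCone d) := by
  obtain ⟨C, hC⟩ := exists_rpow_le_exp (p := d * s) (by positivity)
  set n : ℝ := (Fintype.card (UpperIdx d) : ℝ) with hn
  have hn0 : 0 ≤ n := by positivity
  set c : ℝ := 1 / (2 * (n + 1)) with hc
  have hc0 : 0 < c := by positivity
  have hint : Integrable fun u : UpperIdx d → ℝ => C * ∏ p, Real.exp (-(c * |u p|)) :=
    (Integrable.fintype_prod fun _ => integrable_exp_neg_mul_abs hc0).const_mul C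
  have hcont := continuous_symMat (d := d)
  refine hint.integrableOn.mono' ?_ ?_
  · refine Measurable.aestronglyMeasurable ?_
    refine Measurable.mul (Measurable.pow_const ?_ _) ?_
    · exact Continuous.measurable (by fun_prop)
    · exact Continuous.measurable (by fun_prop)
  · refine (ae_restrict_iff' measurableSet_pdCone).2 (ae_of_all _ fun u hu => ?_)
    have hu' : (symMat d u).PosDef := hu
    have htr : 0 ≤ (symMat d u).trace := hu'.posSemidef.trace_nonneg
    have hdet := hu'.det_pos
    have h1 : (symMat d u).det ^ s ≤ C * Real.exp ((symMat d u).trace / 2) := by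
      refine le_trans ?_ (hC _ htr)
      rw [Real.rpow_mul htr, Real.rpow_natCast]
      exact Real.rpow_le_rpow hdet.le (det_le_trace_pow hu'.posSemidef) hs
    have h2 : Real.exp (-((symMat d u).trace / 2)) ≤ ∏ p, Real.exp (-(c * |u p|)) := by
      rw [← Real.exp_sum, Real.exp_le_exp, Finset.sum_neg_distrib, neg_le_neg_iff,
        ← Finset.mul_sum]
      have h3 : ∑ p, |u p| ≤ n * (symMat d u).trace := by
        have : ∀ p ∈ (Finset.univ : Finset (UpperIdx d)), |u p| ≤ (symMat d u).trace :=
          fun p _ => by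
            have := abs_apply_le_trace hu'.posSemidef p.1.1 p.1.2
            rwa [← upperLin_apply (symMat d u), upperLin_symMat] at this
        simpa [hn] using Finset.sum_le_card_nsmul _ _ _ this
      calc c * ∑ p, |u p| ≤ c * (n * (symMat d u).trace) := by gcongr
        _ ≤ c * ((n + 1) * (symMat d u).trace) := by gcongr; linarith
        _ = _ := by rw [hc]; field_simp
    rw [Real.norm_of_nonneg (by positivity)]
    have hC0 : 0 ≤ C := by
      have := hC 1 zero_le_one
      rw [Real.one_rpow] at this
      exact (pos_of_mul_pos_left (lt_of_lt_of_le one_pos this) (Real.exp_pos _).le).le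
    calc (symMat d u).det ^ s * Real.exp (-(symMat d u).trace)
        ≤ C * Real.exp ((symMat d u).trace / 2) * Real.exp (-(symMat d u).trace) := by gcongr
      _ = C * Real.exp (-((symMat d u).trace / 2)) := by
          rw [mul_assoc, ← Real.exp_add]; congr 2; ring
      _ ≤ _ := by gcongr

/-- The cone contains a ball around the identity matrix. -/
theorem volume_pdCone_pos : 0 < volume (pdCone d) := by
  set ε : ℝ := 1 / (d + 1) with hε
  have hε0 : 0 < ε := by positivity
  refine lt_of_lt_of_le (Metric.measure_ball_pos volume (upperLin d 1) hε0)
    (measure_mono fun u hu => ?_)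
  have hu1 : ∀ p, |u p - upperLin d 1 p| < ε := fun p => by
    have := (dist_pi_lt_iff hε0).1 (Metric.mem_ball.1 hu) p
    rwa [Real.dist_eq] at this
  set D := symMat d u - 1 with hD
  have hDs : D = symMat d (u - upperLin d 1) := by
    rw [map_sub, symMat_upperLin Matrix.transpose_one]
  have hDle : ∀ i j, |D i j| ≤ ε := fun i j => by
    rw [hDs, symMat_apply]
    split_ifs
    · exact (hu1 _).le
    · exact (hu1 _).le
  refine Matrix.PosDef.of_dotProduct_mulVec_pos ?_ fun x hx => ?_
  · rw [Matrix.IsHermitian, Matrix.conjTranspose_eq_transpose_of_trivial, transpose_symMat]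
  · have hu2 : symMat d u = 1 + D := by rw [hD]; abel
    have hpos : 0 < ∑ i, x i ^ 2 := by
      obtain ⟨i, hi⟩ := Function.ne_iff.1 hx
      exact Finset.sum_pos' (fun i _ => sq_nonneg _) ⟨i, Finset.mem_univ i, by
        have : x i ≠ 0 := hi
        positivity⟩
    have h1 : |x ⬝ᵥ (D *ᵥ x)| ≤ ε * (∑ i, |x i|) ^ 2 := by
      calc |x ⬝ᵥ (D *ᵥ x)| ≤ ∑ i, ∑ j, |x i * (D i j * x j)| := by
            rw [dotProduct]
            refine (Finset.abs_sum_le_sum_abs _ _).trans (Finset.sum_le_sum fun i _ => ?_)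
            rw [Matrix.mulVec, dotProduct, Finset.mul_sum]
            exact Finset.abs_sum_le_sum_abs _ _
        _ ≤ ∑ i, ∑ j, ε * (|x i| * |x j|) := by
            refine Finset.sum_le_sum fun i _ => Finset.sum_le_sum fun j _ => ?_
            rw [abs_mul, abs_mul]
            nlinarith [mul_le_mul_of_nonneg_right (hDle i j)
              (mul_nonneg (abs_nonneg (x i)) (abs_nonneg (x j)))]
        _ = ε * (∑ i, |x i|) ^ 2 := by
            rw [sq, Finset.sum_mul_sum, Finset.mul_sum]
            simp only [Finset.mul_sum]
    have h2 : (∑ i, |x i|) ^ 2 ≤ d * ∑ i, x i ^ 2 := by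
      have := sq_sum_le_card_mul_sum_sq (s := Finset.univ) (f := fun i => |x i|)
      simpa using this
    have h3 : ε * (∑ i, |x i|) ^ 2 < ∑ i, x i ^ 2 := by
      calc ε * (∑ i, |x i|) ^ 2 ≤ ε * (d * ∑ i, x i ^ 2) := by gcongr
        _ < ε * ((d + 1) * ∑ i, x i ^ 2) := by gcongr; linarith
        _ = ∑ i, x i ^ 2 := by rw [hε]; field_simp
    have h4 : x ⬝ᵥ x = ∑ i, x i ^ 2 := by simp [dotProduct, sq]
    rw [star_trivial, hu2, Matrix.add_mulVec, Matrix.one_mulVec, dotProduct_add, h4]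
    linarith [neg_abs_le (x ⬝ᵥ (D *ᵥ x))]

theorem multiGamma_pos {a : ℝ} (ha : ((d : ℝ) + 1) / 2 ≤ a) : 0 < multiGamma d a := by
  rw [multiGamma, integral_pdVolume (fun X => X.det ^ (a - ((d : ℝ) + 1) / 2) *
    Real.exp (-X.trace))]
  have hint := integrableOn_det_rpow_mul_exp (d := d) (sub_nonneg.2 ha)
  rw [setIntegral_pos_iff_support_of_nonneg_ae _ hint]
  · rw [Set.inter_eq_self_of_subset_right]
    · exact volume_pdCone_pos
    · intro u hu
      have := Matrix.PosDef.det_pos hu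
      exact (by positivity : 0 < (symMat d u).det ^ (a - ((d : ℝ) + 1) / 2) *
        Real.exp (-(symMat d u).trace)).ne'
  · refine (ae_restrict_iff' measurableSet_pdCone).2 (ae_of_all _ fun u hu => ?_)
    have := Matrix.PosDef.det_pos hu
    simp only [Pi.zero_apply]
    positivity

end Cone

/-! ### The inverse-Wishart normalisation -/

section InverseWishart

variable {d : ℕ}

section Derivative

attribute [local instance] Matrix.linftyOpNormedRing Matrix.linftyOpNormedAlgebra

theorem hasFDerivAt_matrix_inv {Y : Matrix (Fin d) (Fin d) ℝ} (hY : IsUnit Y) :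
    HasFDerivAt (fun X : Matrix (Fin d) (Fin d) ℝ => X⁻¹)
      (-ContinuousLinearMap.mulLeftRight ℝ (Matrix (Fin d) (Fin d) ℝ) Y⁻¹ Y⁻¹) Y := by
  obtain ⟨U, rfl⟩ := hY
  have : CompleteSpace (Matrix (Fin d) (Fin d) ℝ) := FiniteDimensional.complete ℝ _
  have h := hasFDerivAt_ringInverse (𝕜 := ℝ) U
  rw [← Matrix.coe_units_inv]
  have e : (fun X : Matrix (Fin d) (Fin d) ℝ => X⁻¹) = Ring.inverse :=
    funext fun X => Matrix.nonsing_inv_eq_ringInverse X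
  rw [e]
  exact h

/-- The map `X ↦ L X⁻¹ Lᵀ` on symmetric matrices, in the coordinates on and above the diagonal. -/
noncomputable def invConj (L : Matrix (Fin d) (Fin d) ℝ) (u : UpperIdx d → ℝ) : UpperIdx d → ℝ :=
  upperLin d (L * (symMat d u)⁻¹ * Lᵀ)

/-- The derivative of `X ↦ L X⁻¹ Lᵀ` at `X` is minus the congruence by `L X⁻¹`. -/
theorem hasFDerivAt_invConj (L : Matrix (Fin d) (Fin d) ℝ) {u : UpperIdx d → ℝ}
    (hu : u ∈ pdCone d) :
    HasFDerivAt (invConj L)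
      (LinearMap.toContinuousLinearMap (-congruence (L * (symMat d u)⁻¹))) u := by
  let S : (UpperIdx d → ℝ) →L[ℝ] Matrix (Fin d) (Fin d) ℝ :=
    LinearMap.toContinuousLinearMap (symMat d)
  let T : Matrix (Fin d) (Fin d) ℝ →L[ℝ] (UpperIdx d → ℝ) :=
    LinearMap.toContinuousLinearMap
      (upperLin d ∘ₗ LinearMap.mulRight ℝ Lᵀ ∘ₗ LinearMap.mulLeft ℝ L)
  have h1 : HasFDerivAt (fun v => S v) S u := S.hasFDerivAt
  have h2 := hasFDerivAt_matrix_inv (Matrix.PosDef.isUnit hu)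
  have h3 := T.hasFDerivAt.comp u (h2.comp u h1)
  refine h3.congr_fderiv (ContinuousLinearMap.ext fun v => ?_)
  have hsym : ((symMat d u)⁻¹)ᵀ = (symMat d u)⁻¹ := by
    rw [Matrix.transpose_nonsing_inv, transpose_symMat]
  change upperLin d (L * (-((symMat d u)⁻¹ * symMat d v * (symMat d u)⁻¹)) * Lᵀ) =
    -upperLin d (L * (symMat d u)⁻¹ * symMat d v * (L * (symMat d u)⁻¹)ᵀ)
  rw [Matrix.transpose_mul, hsym, ← map_neg]
  simp only [Matrix.mul_assoc, Matrix.mul_neg, Matrix.neg_mul]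

end Derivative

theorem symMat_invConj (L : Matrix (Fin d) (Fin d) ℝ) (u : UpperIdx d → ℝ) :
    symMat d (invConj L u) = L * (symMat d u)⁻¹ * Lᵀ := by
  refine symMat_upperLin ?_
  rw [Matrix.transpose_mul, Matrix.transpose_mul, Matrix.transpose_transpose,
    Matrix.transpose_nonsing_inv, transpose_symMat, Matrix.mul_assoc]

theorem invConj_mem_pdCone {L : Matrix (Fin d) (Fin d) ℝ} (hL : IsUnit L) {u : UpperIdx d → ℝ}
    (hu : u ∈ pdCone d) : invConj L u ∈ pdCone d := by
  rw [pdCone, Set.mem_ofPred_eq, symMat_invConj]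
  exact posDef_mul_mul_transpose (Matrix.PosDef.inv hu) hL

theorem invConj_transpose_invConj {L : Matrix (Fin d) (Fin d) ℝ} (hL : IsUnit L)
    {u : UpperIdx d → ℝ} (hu : u ∈ pdCone d) : invConj Lᵀ (invConj L u) = u := by
  have hLd := (Matrix.isUnit_iff_isUnit_det _).1 hL
  have hLtd : IsUnit Lᵀ.det := by rwa [Matrix.det_transpose]
  have hud := (Matrix.isUnit_iff_isUnit_det _).1 (Matrix.PosDef.isUnit hu)
  rw [invConj, symMat_invConj, Matrix.mul_inv_rev, Matrix.mul_inv_rev,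
    Matrix.nonsing_inv_nonsing_inv _ hud, Matrix.transpose_transpose]
  rw [← Matrix.mul_assoc Lᵀ, Matrix.mul_nonsing_inv _ hLtd, Matrix.one_mul, Matrix.mul_assoc,
    Matrix.nonsing_inv_mul _ hLd, Matrix.mul_one, upperLin_symMat]

theorem invConj_image {L : Matrix (Fin d) (Fin d) ℝ} (hL : IsUnit L) :
    invConj L '' pdCone d = pdCone d := by
  have hLt : IsUnit Lᵀ := by
    rw [Matrix.isUnit_iff_isUnit_det, Matrix.det_transpose]
    exact (Matrix.isUnit_iff_isUnit_det _).1 hL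
  ext u
  constructor
  · rintro ⟨v, hv, rfl⟩
    exact invConj_mem_pdCone hL hv
  · intro hu
    refine ⟨invConj Lᵀ u, invConj_mem_pdCone hLt hu, ?_⟩
    simpa using invConj_transpose_invConj hLt hu

theorem abs_det_deriv_invConj {L : Matrix (Fin d) (Fin d) ℝ} (hL : IsUnit L)
    {u : UpperIdx d → ℝ} (hu : u ∈ pdCone d) :
    |(LinearMap.toContinuousLinearMap (-congruence (L * (symMat d u)⁻¹))).det| =
      (|L.det| / (symMat d u).det) ^ (d + 1) := by
  have hLd : L.det ≠ 0 := ((Matrix.isUnit_iff_isUnit_det _).1 hL).ne_zero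
  have hud := Matrix.PosDef.det_pos hu
  have hB : (L * (symMat d u)⁻¹).det = L.det / (symMat d u).det := by
    rw [Matrix.det_mul, Matrix.det_nonsing_inv, Ring.inverse_eq_inv', div_eq_mul_inv]
  have hB0 : (L * (symMat d u)⁻¹).det ≠ 0 := by
    rw [hB]
    exact div_ne_zero hLd hud.ne'
  rw [ContinuousLinearMap.det, LinearMap.coe_toContinuousLinearMap, ← neg_one_smul ℝ,
    LinearMap.det_smul, det_congruence hB0, hB, abs_mul, abs_pow, abs_neg, abs_one, one_pow,
    one_mul, abs_pow, abs_div, abs_of_pos hud]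

/-- The inverse-Wishart density is proper. With `V = 2 L Lᵀ`, the substitution `X = L Y⁻¹ Lᵀ`,
whose Jacobian is `|L Y⁻¹|^{d+1}`, turns its integral into that defining `Γ_d`. -/
theorem invWishartPDF_integrable_integral {v : ℝ} {V : Matrix (Fin d) (Fin d) ℝ} (hV : V.PosDef)
    (hv : 2 * (d : ℝ) + 2 ≤ v) :
    Integrable (fun X : PDMat d => invWishartPDF v V X.1) (pdVolume d) ∧
      ∫ X : PDMat d, invWishartPDF v V X.1 ∂pdVolume d = 1 := by
  obtain ⟨L, hL, hLV⟩ := exists_mul_transpose_eq (hV.smul (by norm_num : (0 : ℝ) < 1 / 2))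
  have hLd := (Matrix.isUnit_iff_isUnit_det _).1 hL
  have hLtd : IsUnit Lᵀ.det := by rwa [Matrix.det_transpose]
  have hV2 : V = (2 : ℝ) • (L * Lᵀ) := by rw [hLV, smul_smul]; norm_num
  set a : ℝ := (v - d - 1) / 2 with ha
  have hga : 0 < multiGamma d a := multiGamma_pos (by rw [ha]; linarith)
  set l : ℝ := |L.det| with hl
  have hl0 : 0 < l := abs_pos.2 hLd.ne_zero
  -- all powers are real powers of `l`, the determinant of `Y` and `2`
  have hLL : (L * Lᵀ).det = l ^ (2 : ℝ) := by
    rw [Matrix.det_mul, Matrix.det_transpose, hl, Real.rpow_two, sq_abs, sq]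
  have hval : ∀ u ∈ pdCone d,
      |(LinearMap.toContinuousLinearMap (-congruence (L * (symMat d u)⁻¹))).det| •
        invWishartPDF v V (symMat d (invConj L u)) =
      (multiGamma d a)⁻¹ * ((symMat d u).det ^ (a - ((d : ℝ) + 1) / 2) *
        Real.exp (-(symMat d u).trace)) := by
    intro u hu
    have hy := Matrix.PosDef.det_pos hu
    have hud := (Matrix.isUnit_iff_isUnit_det _).1 (Matrix.PosDef.isUnit hu)
    rw [abs_det_deriv_invConj hL hu, symMat_invConj, invWishartPDF, smul_eq_mul]
    have htr : (V * (L * (symMat d u)⁻¹ * Lᵀ)⁻¹).trace = 2 * (symMat d u).trace := by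
      rw [Matrix.mul_inv_rev, Matrix.mul_inv_rev, Matrix.nonsing_inv_nonsing_inv _ hud, hV2,
        Matrix.smul_mul, Matrix.trace_smul, smul_eq_mul, Matrix.mul_assoc L, ← Matrix.mul_assoc Lᵀ,
        Matrix.mul_nonsing_inv _ hLtd, Matrix.one_mul, ← Matrix.mul_assoc, Matrix.trace_mul_comm,
        ← Matrix.mul_assoc, Matrix.nonsing_inv_mul _ hLd, Matrix.one_mul]
    have hX : (L * (symMat d u)⁻¹ * Lᵀ).det = l ^ (2 : ℝ) / (symMat d u).det := by
      rw [← hLL, Matrix.det_mul, Matrix.det_mul, Matrix.det_mul, Matrix.det_nonsing_inv,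
        Ring.inverse_eq_inv']
      ring
    have hVd : V.det = 2 ^ (d : ℝ) * l ^ (2 : ℝ) := by
      rw [hV2, Matrix.det_smul, Fintype.card_fin, hLL, Real.rpow_natCast]
    have h2 : -(1 / 2) * (2 * (symMat d u).trace) = -(symMat d u).trace := by ring
    rw [htr, hX, hVd, h2, ← ha]
    set y := (symMat d u).det with hydef
    have e1 : (l / y) ^ (d + 1) = l ^ ((d : ℝ) + 1) / y ^ ((d : ℝ) + 1) := by
      rw [← Real.rpow_natCast, Real.div_rpow hl0.le hy.le]
      push_cast
      rfl
    have e2 : (2 ^ (d : ℝ) * l ^ (2 : ℝ)) ^ a = 2 ^ (a * d) * l ^ (2 * a) := by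
      rw [Real.mul_rpow (by positivity) (by positivity), ← Real.rpow_mul (by norm_num),
        ← Real.rpow_mul hl0.le, mul_comm (d : ℝ)]
    have e3 : (l ^ (2 : ℝ) / y) ^ (v / 2) = l ^ v / y ^ (v / 2) := by
      rw [Real.div_rpow (by positivity) hy.le, ← Real.rpow_mul hl0.le]
      congr 2
      ring
    have e4 : (v - d - 1) * d / 2 = a * d := by rw [ha]; ring
    have e5 : l ^ v = l ^ ((d : ℝ) + 1) * l ^ (2 * a) := by
      rw [← Real.rpow_add hl0]
      congr 1
      rw [ha]; ring
    have e6 : y ^ (v / 2) = y ^ (a - ((d : ℝ) + 1) / 2) * y ^ ((d : ℝ) + 1) := by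
      rw [← Real.rpow_add hy]
      congr 1
      rw [ha]; ring
    rw [e1, e2, e3, e4, e5, e6]
    have p1 : (0 : ℝ) < 2 ^ (a * d) := by positivity
    have p2 : 0 < l ^ ((d : ℝ) + 1) := by positivity
    have p3 : 0 < l ^ (2 * a) := by positivity
    have p4 : 0 < y ^ ((d : ℝ) + 1) := by positivity
    have p5 : 0 < y ^ (a - ((d : ℝ) + 1) / 2) := by positivity
    field_simp
  have hderiv : ∀ u ∈ pdCone d, HasFDerivWithinAt (invConj L)
      (LinearMap.toContinuousLinearMap (-congruence (L * (symMat d u)⁻¹))) (pdCone d) u :=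
    fun u hu => (hasFDerivAt_invConj L hu).hasFDerivWithinAt
  have hinj : Set.InjOn (invConj L) (pdCone d) := fun u hu w hw h => by
    rw [← invConj_transpose_invConj hL hu, h, invConj_transpose_invConj hL hw]
  constructor
  · rw [integrable_pdVolume_iff (invWishartPDF v V), ← invConj_image hL,
      integrableOn_image_iff_integrableOn_abs_det_fderiv_smul volume measurableSet_pdCone hderiv
        hinj]
    refine IntegrableOn.congr_fun ?_ (fun u hu => (hval u hu).symm) measurableSet_pdCone
    exact (integrableOn_det_rpow_mul_exp (by rw [ha]; linarith)).const_mul _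
  · rw [integral_pdVolume (invWishartPDF v V), ← invConj_image hL,
      integral_image_eq_integral_abs_det_fderiv_smul volume measurableSet_pdCone hderiv hinj,
      setIntegral_congr_fun measurableSet_pdCone hval, integral_const_mul,
      ← integral_pdVolume (fun X => X.det ^ (a - ((d : ℝ) + 1) / 2) * Real.exp (-X.trace)),
      ← multiGamma, inv_mul_cancel₀ hga.ne']

end InverseWishart

/-! ### Integrals over the state spaces -/

section StateSpace

theorem measurableEmbedding_sigmaMk {α : Type*} {β : α → Type*} [∀ a, MeasurableSpace (β a)]
    (a : α) : MeasurableEmbedding (Sigma.mk a : β a → Sigma β) where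
  injective := sigma_mk_injective
  measurable := fun _ hs => MeasurableSpace.measurableSet_iInf.1 hs a
  measurableSet_image' := by
    intro s hs
    refine MeasurableSpace.measurableSet_iInf.2 fun b => ?_
    change MeasurableSet (Sigma.mk b ⁻¹' (Sigma.mk a '' s))
    by_cases h : b = a
    · subst h
      rwa [Set.preimage_image_eq _ sigma_mk_injective]
    · rw [Set.preimage_image_sigmaMk_of_ne h]
      exact MeasurableSet.empty

theorem measurableEmbedding_inl {α β : Type*} [MeasurableSpace α] [MeasurableSpace β] :
    MeasurableEmbedding (Sum.inl : α → α ⊕ β) :=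
  ⟨Sum.inl_injective, measurable_inl, fun _ hs => hs.inl_image⟩

theorem measurableEmbedding_inr {α β : Type*} [MeasurableSpace α] [MeasurableSpace β] :
    MeasurableEmbedding (Sum.inr : β → α ⊕ β) :=
  ⟨Sum.inr_injective, measurable_inr, fun _ hs => hs.inr_image⟩

instance instCountableTrajIdx (k : ℕ) : Countable (TrajIdx k) :=
  inferInstanceAs (Countable {p : ℕ × ℕ // 1 ≤ p.1 ∧ p.1 ≤ k ∧ 1 ≤ p.2 ∧ p.1 + p.2 ≤ k + 1})

instance instSFiniteTrajVolume (k nx : ℕ) : SFinite (trajVolume k nx) := by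
  unfold trajVolume
  infer_instance

variable {k nx d : ℕ}

theorem GaussComp.density_mk (c : GaussComp k nx) (x : StateSeq nx c.idx) :
    c.density ⟨c.idx, x⟩ = gaussPDF c.mean c.cov x := dif_pos rfl

theorem GaussComp.density_of_ne (c : GaussComp k nx) {X : Traj k nx} (h : X.1 ≠ c.idx) :
    c.density X = 0 := dif_neg h

theorem GaussComp.density_integrable_integral (c : GaussComp k nx) (hc : c.cov.PosDef) :
    Integrable c.density (trajVolume k nx) ∧ ∫ X, c.density X ∂trajVolume k nx = 1 := by
  have hg := gaussPDF_integrable_integral c.mean hc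
  have hzero : ∀ p, p ≠ c.idx →
      c.density ∘ (Sigma.mk p : StateSeq nx p → Traj k nx) = 0 := fun p hp =>
    funext fun x => c.density_of_ne (X := ⟨p, x⟩) hp
  have hself : c.density ∘ (Sigma.mk c.idx : StateSeq nx c.idx → Traj k nx) =
      gaussPDF c.mean c.cov := funext c.density_mk
  have hmap : ∀ p (f : Traj k nx → ℝ),
      ∫ X, f X ∂((volume : Measure (StateSeq nx p)).map fun x => (⟨p, x⟩ : Traj k nx)) =
        ∫ x, (f ∘ (Sigma.mk p : StateSeq nx p → Traj k nx)) x := fun p f =>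
    (measurableEmbedding_sigmaMk p).integral_map f
  have hint : Integrable c.density (trajVolume k nx) := by
    refine integrable_sum_measure (fun p => ?_) ?_
    · refine (measurableEmbedding_sigmaMk p).integrable_map_iff.2 ?_
      by_cases hp : p = c.idx
      · subst hp
        rw [hself]
        exact hg.1
      · rw [hzero p hp]
        exact integrable_zero _ _ _
    · refine summable_of_ne_finset_zero (s := {c.idx}) fun p hp => ?_
      have h0 := hzero p (by simpa using hp)
      have h0' : (fun X => ‖c.density X‖) ∘ (Sigma.mk p : StateSeq nx p → Traj k nx) = 0 :=
        funext fun x => by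
          have := congrFun h0 x
          simp only [Function.comp_apply, Pi.zero_apply] at this ⊢
          rw [this, norm_zero]
      rw [hmap p (fun X => ‖c.density X‖), h0']
      simp
  refine ⟨hint, ?_⟩
  rw [trajVolume, integral_sum_measure hint, tsum_eq_single c.idx, hmap, hself, hg.2]
  intro p hp
  rw [hmap, hzero p hp]
  simp

instance instSFiniteRate :
    SFinite ((volume : Measure ℝ).comap (Subtype.val : Set.Ioi (0 : ℝ) → ℝ)) := by
  have h := SigmaFinite.of_map ((volume : Measure ℝ).comap (Subtype.val : Set.Ioi (0 : ℝ) → ℝ))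
    measurable_subtype_coe.aemeasurable
    (by rw [map_comap_subtype_coe measurableSet_Ioi]; infer_instance)
  infer_instance

theorem gammaPDFReal_integrable_integral {a b : ℝ} (ha : 0 < a) (hb : 0 < b) :
    Integrable (fun t : Set.Ioi (0 : ℝ) => ProbabilityTheory.gammaPDFReal a b t)
        ((volume : Measure ℝ).comap Subtype.val) ∧
      ∫ t : Set.Ioi (0 : ℝ), ProbabilityTheory.gammaPDFReal a b t
        ∂((volume : Measure ℝ).comap Subtype.val) = 1 := by
  have hval : ∀ t ∈ Set.Ioi (0 : ℝ), ProbabilityTheory.gammaPDFReal a b t =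
      b ^ a / Real.Gamma a * (t ^ (a - 1) * Real.exp (-(b * t))) := fun t ht => by
    rw [ProbabilityTheory.gammaPDFReal, if_pos (Set.mem_Ioi.1 ht).le, mul_assoc]
  have hG := Real.Gamma_pos_of_pos ha
  have hI := Real.integral_rpow_mul_exp_neg_mul_Ioi ha hb
  have hne : ∫ t in Set.Ioi (0 : ℝ), t ^ (a - 1) * Real.exp (-(b * t)) ≠ 0 := by
    rw [hI]
    positivity
  have hemb := MeasurableEmbedding.subtype_coe (measurableSet_Ioi (a := (0 : ℝ)))
  constructor
  · have h := hemb.integrable_map_iff (μ := (volume : Measure ℝ).comap Subtype.val)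
      (g := ProbabilityTheory.gammaPDFReal a b)
    rw [map_comap_subtype_coe measurableSet_Ioi] at h
    refine h.1 ?_
    exact IntegrableOn.congr_fun ((Integrable.of_integral_ne_zero hne).const_mul _)
      (fun t ht => (hval t ht).symm) measurableSet_Ioi
  · rw [← hemb.integral_map, map_comap_subtype_coe measurableSet_Ioi,
      setIntegral_congr_fun measurableSet_Ioi hval, integral_const_mul, hI]
    rw [Real.div_rpow zero_le_one hb.le, Real.one_rpow]
    field_simp

theorem ExtComp.phd_integrable_integral (c : ExtComp k nx d) (hc : c.Valid) :
    Integrable c.phd (extVolume k nx d) ∧ ∫ X, c.phd X ∂extVolume k nx d = c.weight := by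
  obtain ⟨⟨-, -, hP⟩, ha, hb, hv, hV⟩ := hc
  have h1 := c.density_integrable_integral hP
  have h2 := gammaPDFReal_integrable_integral ha hb
  have h3 := invWishartPDF_integrable_integral hV hv.le
  have he : c.phd = fun X : ExtState k nx d => c.weight * (c.density X.1 *
      (ProbabilityTheory.gammaPDFReal c.a c.b X.2.1 * invWishartPDF c.v c.V X.2.2.1)) :=
    funext fun X => by rw [ExtComp.phd]; ring
  rw [he]
  refine ⟨(h1.1.mul_prod (h2.1.mul_prod h3.1)).const_mul _, ?_⟩
  rw [integral_const_mul, extVolume,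
    integral_prod_mul c.density (fun Y : Set.Ioi (0 : ℝ) × PDMat d =>
      ProbabilityTheory.gammaPDFReal c.a c.b Y.1 * invWishartPDF c.v c.V Y.2.1),
    integral_prod_mul (fun t : Set.Ioi (0 : ℝ) => ProbabilityTheory.gammaPDFReal c.a c.b t)
      (fun Y : PDMat d => invWishartPDF c.v c.V Y.1), h1.2, h2.2, h3.2]
  ring

theorem integrable_coVolume_iff {f : CoState k nx d → ℝ} :
    Integrable f (coVolume k nx d) ↔
      Integrable (fun X => f (Sum.inl X)) (trajVolume k nx) ∧
        Integrable (fun X => f (Sum.inr X)) (extVolume k nx d) := by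
  rw [coVolume, integrable_add_measure, measurableEmbedding_inl.integrable_map_iff,
    measurableEmbedding_inr.integrable_map_iff]
  rfl

theorem integral_coVolume {f : CoState k nx d → ℝ} (hf : Integrable f (coVolume k nx d)) :
    ∫ X, f X ∂coVolume k nx d =
      ∫ X, f (Sum.inl X) ∂trajVolume k nx + ∫ X, f (Sum.inr X) ∂extVolume k nx d := by
  rw [coVolume, integrable_add_measure] at hf
  rw [coVolume, integral_add_measure hf.1 hf.2, measurableEmbedding_inl.integral_map,
    measurableEmbedding_inr.integral_map]

/-- The PHD of a mixture integrates to the sum of the weights. -/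
theorem mixturePHD_integrable_integral {Jp Je : ℕ} (pc : Fin Jp → GaussComp k nx)
    (ec : Fin Je → ExtComp k nx d) (hpc : ∀ i, (pc i).Valid) (hec : ∀ j, (ec j).Valid) :
    Integrable (mixturePHD pc ec) (coVolume k nx d) ∧
      ∫ X, mixturePHD pc ec X ∂coVolume k nx d = ∑ i, (pc i).weight + ∑ j, (ec j).weight := by
  have h1 : ∀ i, Integrable (pc i).phd (trajVolume k nx) := fun i =>
    ((pc i).density_integrable_integral (hpc i).2.2).1.const_mul _
  have h2 := fun j => ((ec j).phd_integrable_integral (hec j)).1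
  have hint : Integrable (mixturePHD pc ec) (coVolume k nx d) :=
    integrable_coVolume_iff.2 ⟨integrable_finsetSum _ fun i _ => h1 i,
      integrable_finsetSum _ fun j _ => h2 j⟩
  refine ⟨hint, ?_⟩
  rw [integral_coVolume hint]
  simp only [mixturePHD]
  rw [integral_finsetSum _ fun i _ => h1 i, integral_finsetSum _ fun j _ => h2 j]
  congr 1
  · refine Finset.sum_congr rfl fun i _ => ?_
    simp only [GaussComp.phd]
    rw [integral_const_mul, ((pc i).density_integrable_integral (hpc i).2.2).2, mul_one]
  · exact Finset.sum_congr rfl fun j _ => ((ec j).phd_integrable_integral (hec j)).2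

end StateSpace

/-! ### The Kalman update of a trajectory -/

section Kalman

variable {k nx d : ℕ}

/-- The observation matrix of the whole trajectory, `H` applied to the latest state. -/
def trajObs (H : Matrix (Fin d) (Fin nx) ℝ) (p : TrajIdx k) :
    Matrix (Fin d) (Fin p.len × Fin nx) ℝ :=
  Matrix.of fun i s => if s.1 = p.last then H i s.2 else 0

theorem sum_ite_last (p : TrajIdx k) (f : Fin p.len × Fin nx → ℝ) :
    ∑ s, (if s.1 = p.last then f s else 0) = ∑ r, f (p.last, r) := by
  rw [Fintype.sum_prod_type, Finset.sum_eq_single p.last]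
  · simp
  · intro b _ hb
    simp [hb]
  · simp

theorem trajObs_mulVec (H : Matrix (Fin d) (Fin nx) ℝ) (p : TrajIdx k) (x : StateSeq nx p) :
    trajObs H p *ᵥ x = H *ᵥ fun r => x (p.last, r) := by
  ext i
  simp only [Matrix.mulVec, dotProduct, trajObs, Matrix.of_apply, ite_mul, zero_mul]
  exact sum_ite_last p fun s => H i s.2 * x s

theorem GaussComp.mul_trajObs_transpose (c : GaussComp k nx) (H : Matrix (Fin d) (Fin nx) ℝ) :
    c.cov * (trajObs H c.idx)ᵀ = c.covAllK * Hᵀ := by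
  ext s i
  simp only [Matrix.mul_apply, Matrix.transpose_apply, trajObs, Matrix.of_apply, mul_ite, mul_zero]
  exact sum_ite_last c.idx fun t => c.cov s t * H i t.2

theorem GaussComp.trajObs_mul (c : GaussComp k nx) (H : Matrix (Fin d) (Fin nx) ℝ) :
    trajObs H c.idx * c.cov = H * c.covKAll := by
  ext i s
  simp only [Matrix.mul_apply, trajObs, Matrix.of_apply, ite_mul, zero_mul]
  exact sum_ite_last c.idx fun t => H i t.2 * c.cov t s

theorem GaussComp.trajObs_mul_mul_transpose (c : GaussComp k nx)
    (H : Matrix (Fin d) (Fin nx) ℝ) :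
    trajObs H c.idx * c.cov * (trajObs H c.idx)ᵀ = H * c.covKK * Hᵀ := by
  rw [c.trajObs_mul, Matrix.mul_assoc, Matrix.mul_assoc]
  congr 1
  ext s i
  simp only [Matrix.mul_apply, Matrix.transpose_apply, trajObs, Matrix.of_apply, mul_ite, mul_zero]
  exact sum_ite_last c.idx fun t => c.covKAll s t * H i t.2

theorem GaussComp.innovCov_eq (c : GaussComp k nx) (H : Matrix (Fin d) (Fin nx) ℝ)
    (E : Matrix (Fin d) (Fin d) ℝ) :
    c.innovCov H E = trajObs H c.idx * c.cov * (trajObs H c.idx)ᵀ + E := by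
  rw [c.trajObs_mul_mul_transpose, GaussComp.innovCov]

theorem GaussComp.gain_eq (c : GaussComp k nx) (H : Matrix (Fin d) (Fin nx) ℝ)
    (E : Matrix (Fin d) (Fin d) ℝ) :
    c.gain H E = c.cov * (trajObs H c.idx)ᵀ *
      (trajObs H c.idx * c.cov * (trajObs H c.idx)ᵀ + E)⁻¹ := by
  rw [GaussComp.gain, c.mul_trajObs_transpose, c.innovCov_eq]

theorem GaussComp.kalman_cov_eq (c : GaussComp k nx) (H : Matrix (Fin d) (Fin nx) ℝ)
    (E : Matrix (Fin d) (Fin d) ℝ) (y : Meas d) (ω : ℝ) :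
    (c.kalman H E y ω).cov = c.cov - c.cov * (trajObs H c.idx)ᵀ *
      (trajObs H c.idx * c.cov * (trajObs H c.idx)ᵀ + E)⁻¹ * trajObs H c.idx * c.cov := by
  change c.cov - c.gain H E * H * c.covKAll = _
  rw [Matrix.mul_assoc (c.gain H E), ← c.trajObs_mul, ← Matrix.mul_assoc, c.gain_eq]

theorem GaussComp.posDef_innovCov {c : GaussComp k nx} (hc : c.cov.PosDef)
    (H : Matrix (Fin d) (Fin nx) ℝ) {E : Matrix (Fin d) (Fin d) ℝ} (hE : E.PosDef) :
    (c.innovCov H E).PosDef := by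
  rw [c.innovCov_eq]
  exact posDef_innovation hc hE _

theorem GaussComp.Valid.kalman {c : GaussComp k nx} (hc : c.Valid)
    (H : Matrix (Fin d) (Fin nx) ℝ) {E : Matrix (Fin d) (Fin d) ℝ} (hE : E.PosDef) (y : Meas d)
    {ω : ℝ} (hω : 0 ≤ ω) : (c.kalman H E y ω).Valid := by
  refine ⟨hω, hc.2.1, ?_⟩
  rw [c.kalman_cov_eq]
  exact posDef_kalman_cov hc.2.2 hE _

/-- The Kalman factorisation for a Gaussian trajectory component; the weight `ω` does not enter. -/
theorem GaussComp.gaussPDF_mul_density {c : GaussComp k nx} (hc : c.cov.PosDef)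
    (H : Matrix (Fin d) (Fin nx) ℝ) {E : Matrix (Fin d) (Fin d) ℝ} (hE : E.PosDef) (y : Meas d)
    (ω : ℝ) (X : Traj k nx) :
    gaussPDF (H *ᵥ X.cur) E y * c.density X =
      gaussPDF (H *ᵥ c.meanK) (c.innovCov H E) y * (c.kalman H E y ω).density X := by
  obtain ⟨p, x⟩ := X
  by_cases hp : p = c.idx
  · subst hp
    have h2 : (c.kalman H E y ω).density ⟨c.idx, x⟩ =
        gaussPDF (c.kalman H E y ω).mean (c.kalman H E y ω).cov x :=
      (c.kalman H E y ω).density_mk x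
    have hmean : (c.kalman H E y ω).mean =
        c.mean + c.gain H E *ᵥ (y - H *ᵥ c.meanK) := rfl
    have hcur : H *ᵥ Traj.cur (⟨c.idx, x⟩ : Traj k nx) = trajObs H c.idx *ᵥ x :=
      (trajObs_mulVec H c.idx x).symm
    have hm : H *ᵥ c.meanK = trajObs H c.idx *ᵥ c.mean := (trajObs_mulVec H c.idx c.mean).symm
    rw [c.density_mk, h2, hmean, c.kalman_cov_eq, hcur, hm, c.innovCov_eq, c.gain_eq]
    exact gaussPDF_mul_gaussPDF hc hE _ _ _ _
  · rw [c.density_of_ne (X := ⟨p, x⟩) hp,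
      (c.kalman H E y ω).density_of_ne (X := ⟨p, x⟩) hp, mul_zero, mul_zero]

end Kalman

/-! ### The likelihood of a cell -/

section Cell

variable {d : ℕ}

theorem posDef_meanNoise {w : Finset (Meas d)} (hw : w.Nonempty) {E : Matrix (Fin d) (Fin d) ℝ}
    (hE : E.PosDef) : (meanNoise w E).PosDef :=
  hE.smul (inv_pos.2 (Nat.cast_pos.2 hw.card_pos))

theorem posSemidef_cellScatter (w : Finset (Meas d)) : (cellScatter w).PosSemidef :=
  Matrix.posSemidef_sum _ fun _ _ => posSemidef_vecMulVec_self _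

theorem sum_sub_cellMean {w : Finset (Meas d)} (hw : w.Nonempty) :
    ∑ z ∈ w, (z - cellMean w) = 0 := by
  have hn : (w.card : ℝ) ≠ 0 := Nat.cast_ne_zero.2 hw.card_pos.ne'
  rw [Finset.sum_sub_distrib, Finset.sum_const, cellMean, ← Nat.cast_smul_eq_nsmul ℝ, smul_smul,
    mul_inv_cancel₀ hn, one_smul, sub_self]

/-- The sum of the squared Mahalanobis distances of a cell to a point `y`, split into the scatter
around the mean and the distance of the mean to `y`. -/
theorem sum_quadratic_cell {w : Finset (Meas d)} (hw : w.Nonempty) (y : Meas d)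
    (A : Matrix (Fin d) (Fin d) ℝ) :
    ∑ z ∈ w, (z - y) ⬝ᵥ (A *ᵥ (z - y)) =
      (cellScatter w * A).trace + w.card * ((cellMean w - y) ⬝ᵥ (A *ᵥ (cellMean w - y))) := by
  have h0 := sum_sub_cellMean hw
  set m := cellMean w with hm
  have hz : ∀ z ∈ w, (z - y) ⬝ᵥ (A *ᵥ (z - y)) =
      (z - m) ⬝ᵥ (A *ᵥ (z - m)) + (z - m) ⬝ᵥ (A *ᵥ (m - y)) + (m - y) ⬝ᵥ (A *ᵥ (z - m)) +
        (m - y) ⬝ᵥ (A *ᵥ (m - y)) := fun z _ => by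
    have : z - y = (z - m) + (m - y) := by abel
    rw [this, Matrix.mulVec_add, add_dotProduct, dotProduct_add, dotProduct_add]
    ring
  rw [Finset.sum_congr rfl hz]
  simp only [Finset.sum_add_distrib]
  rw [← sum_dotProduct, ← dotProduct_sum, ← Matrix.mulVec_sum, h0]
  simp only [zero_dotProduct, Matrix.mulVec_zero, dotProduct_zero, add_zero, Finset.sum_const,
    nsmul_eq_mul]
  congr 1
  rw [cellScatter, Finset.sum_mul, Matrix.trace_sum]
  exact Finset.sum_congr rfl fun z _ => dotProduct_mulVec_eq_trace A _

/-- The mean of a cell is sufficient for the common mean `y` of its measurements: the remaining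
factor does not depend on `y`. -/
theorem prod_gaussPDF_cell {w : Finset (Meas d)} (hw : w.Nonempty)
    {E : Matrix (Fin d) (Fin d) ℝ} (hE : E.PosDef) (y : Meas d) :
    ∏ z ∈ w, gaussPDF y E z = scatterFactor w E * gaussPDF y (meanNoise w E) (cellMean w) := by
  have hn0 : 0 < (w.card : ℝ) := Nat.cast_pos.2 hw.card_pos
  have hE0 := hE.det_pos
  have hEd := (Matrix.isUnit_iff_isUnit_det _).1 hE.isUnit
  have hsum := sum_quadratic_cell hw y E⁻¹
  have hinv : (meanNoise w E)⁻¹ = (w.card : ℝ) • E⁻¹ := by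
    refine Matrix.inv_eq_right_inv ?_
    rw [meanNoise, Matrix.smul_mul, Matrix.mul_smul, smul_smul, inv_mul_cancel₀ hn0.ne',
      one_smul, Matrix.mul_nonsing_inv _ hEd]
  have hdet : (meanNoise w E).det ^ (-(1 : ℝ) / 2) =
      (w.card : ℝ) ^ ((d : ℝ) / 2) * E.det ^ (-(1 : ℝ) / 2) := by
    rw [meanNoise, Matrix.det_smul, Fintype.card_fin, Real.mul_rpow (by positivity) hE0.le,
      ← Real.rpow_natCast, ← Real.rpow_neg_one, ← Real.rpow_mul hn0.le, ← Real.rpow_mul hn0.le]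
    congr 2
    ring
  unfold scatterFactor gaussPDF
  rw [hdet, hinv, Finset.prod_mul_distrib, Finset.prod_const, ← Real.exp_sum, ← Finset.mul_sum,
    hsum, Matrix.smul_mulVec, dotProduct_smul, smul_eq_mul, mul_add, Real.exp_add, mul_pow,
    ← Real.rpow_natCast, ← Real.rpow_natCast, ← Real.rpow_mul (by positivity),
    ← Real.rpow_mul hE0.le, Fintype.card_fin]
  have e1 : (2 * Real.pi) ^ (-(d : ℝ) / 2 * w.card) =
      (2 * Real.pi) ^ (-((w.card : ℝ) - 1) * d / 2) * (2 * Real.pi) ^ (-(d : ℝ) / 2) := by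
    rw [← Real.rpow_add (by positivity)]
    congr 1; ring
  have e2 : E.det ^ (-(1 : ℝ) / 2 * w.card) =
      E.det ^ (-((w.card : ℝ) - 1) / 2) * E.det ^ (-(1 : ℝ) / 2) := by
    rw [← Real.rpow_add hE0]
    congr 1; ring
  have e3 : (w.card : ℝ) ^ (-(d : ℝ) / 2) * (w.card : ℝ) ^ ((d : ℝ) / 2) = 1 := by
    rw [← Real.rpow_add hn0, neg_div, neg_add_cancel, Real.rpow_zero]
  rw [e1, e2]
  linear_combination -((2 * Real.pi) ^ (-((w.card : ℝ) - 1) * d / 2) *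
    (2 * Real.pi) ^ (-(d : ℝ) / 2) * E.det ^ (-((w.card : ℝ) - 1) / 2) *
    E.det ^ (-(1 : ℝ) / 2) * Real.exp (-(1 / 2) * (cellScatter w * E⁻¹).trace) *
    Real.exp (-(1 / 2) * (w.card * ((cellMean w - y) ⬝ᵥ E⁻¹ *ᵥ (cellMean w - y))))) * e3

end Cell

/-! ### Exactness of the Kalman-factorised joint intensity -/

section Exact

variable {k nx d Jp Je : ℕ}

theorem ExtComp.posDef_extent {c : ExtComp k nx d} (hc : c.Valid) : c.extent.PosDef :=
  hc.2.2.2.2.smul (inv_pos.2 (by linarith [hc.2.2.2.1]))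

/-- The Kalman-factorised joint intensity without substitution is `f(𝐰 | X) λ(X)`. -/
theorem lik_mul_mixturePHD (M : Sensor nx d) (pc : Fin Jp → GaussComp k nx)
    (ec : Fin Je → ExtComp k nx d) (hec : ∀ j, (ec j).Valid) (w : Finset (Meas d))
    (X : CoState k nx d) :
    M.lik w X * mixturePHD pc ec X = exactJoint M pc ec w X := by
  rcases X with X | X
  · rfl
  · simp only [mixturePHD, exactJoint, joint]
    split_ifs with h
    · rfl
    · have hw : w.Nonempty := Finset.card_ne_zero.1 h
      rw [Finset.mul_sum]
      refine Finset.sum_congr rfl fun j _ => ?_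
      have hE : X.2.2.1.PosDef := X.2.2.2
      have hk := GaussComp.gaussPDF_mul_density (hec j).1.2.2 M.H (posDef_meanNoise hw hE)
        (cellMean w) 1 X.1
      simp only [Sensor.lik, if_neg h, ExtComp.phd, ExtComp.cellJoint, ExtComp.exactInnov]
      rw [prod_gaussPDF_cell hw hE]
      linear_combination (M.pD * (X.2.1 : ℝ) ^ w.card * Real.exp (-(X.2.1 : ℝ)) *
        scatterFactor w X.2.2.1 * (ec j).weight *
        ProbabilityTheory.gammaPDFReal (ec j).a (ec j).b X.2.1 *
        invWishartPDF (ec j).v (ec j).V X.2.2.1) * hk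

theorem ExtComp.ggiwInnov_extent {c : ExtComp k nx d} (hc : c.Valid) (M : Sensor nx d)
    {sq : Matrix (Fin d) (Fin d) ℝ → Matrix (Fin d) (Fin d) ℝ}
    (hsq : ∀ E : Matrix (Fin d) (Fin d) ℝ, E.PosDef → sq E * (sq E)ᵀ = E)
    {w : Finset (Meas d)} (hw : w.Nonempty) :
    c.ggiwInnov M sq w c.extent = c.exactInnov M w c.extent := by
  have hX := c.posDef_extent hc
  have hS : (c.S M.H w).PosDef := GaussComp.posDef_innovCov hc.1.2.2 M.H (posDef_meanNoise hw hX)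
  have hXu := (Matrix.isUnit_iff_isUnit_det _).1
    (isUnit_of_mul_transpose_posDef hX (hsq _ hX))
  have hXtu : IsUnit (sq c.extent)ᵀ.det := by rwa [Matrix.det_transpose]
  change sq (c.S M.H w) * (sq c.extent)⁻¹ * c.extent * (sq (c.S M.H w) * (sq c.extent)⁻¹)ᵀ =
    c.S M.H w
  conv_lhs => rw [← hsq _ hX]
  have hin : (sq (sq c.extent * (sq c.extent)ᵀ)) = sq c.extent := by rw [hsq _ hX]
  rw [hin, Matrix.transpose_mul, Matrix.transpose_nonsing_inv, Matrix.mul_assoc (sq (c.S M.H w)),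
    ← Matrix.mul_assoc (sq c.extent)⁻¹, Matrix.nonsing_inv_mul _ hXu, Matrix.one_mul,
    Matrix.mul_assoc, ← Matrix.mul_assoc (sq c.extent)ᵀ, Matrix.mul_nonsing_inv _ hXtu,
    Matrix.one_mul, hsq _ hS]

end Exact

/-! ### Conjugacy of the approximated joint intensity -/

section Conjugacy

variable {k nx d : ℕ}

/-- The Gamma density is conjugate to the Poisson likelihood. -/
theorem poisson_mul_gammaPDFReal {a b t : ℝ} (ha : 0 < a) (hb : 0 < b) (ht : 0 < t) (n : ℕ) :
    t ^ n * Real.exp (-t) * ProbabilityTheory.gammaPDFReal a b t =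
      Real.Gamma (a + n) * b ^ a / (Real.Gamma a * (b + 1) ^ (a + n)) *
        ProbabilityTheory.gammaPDFReal (a + n) (b + 1) t := by
  rw [ProbabilityTheory.gammaPDFReal, ProbabilityTheory.gammaPDFReal, if_pos ht.le, if_pos ht.le]
  have h1 := (Real.Gamma_pos_of_pos ha).ne'
  have h2 := (Real.Gamma_pos_of_pos (add_pos_of_pos_of_nonneg ha (Nat.cast_nonneg n))).ne'
  have h3 : ((b + 1) ^ (a + n) : ℝ) ≠ 0 := by positivity
  have e1 : t ^ (a + n - 1) = t ^ n * t ^ (a - 1) := by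
    rw [← Real.rpow_natCast, ← Real.rpow_add ht]
    congr 1; ring
  have e2 : Real.exp (-((b + 1) * t)) = Real.exp (-t) * Real.exp (-(b * t)) := by
    rw [← Real.exp_add]
    congr 1; ring
  rw [e1, e2]
  field_simp

variable {c : ExtComp k nx d} {H : Matrix (Fin d) (Fin nx) ℝ}
  {sq : Matrix (Fin d) (Fin d) ℝ → Matrix (Fin d) (Fin d) ℝ} {w : Finset (Meas d)}

theorem ExtComp.N_eq_vecMulVec (c : ExtComp k nx d) (H : Matrix (Fin d) (Fin nx) ℝ)
    (sq : Matrix (Fin d) (Fin d) ℝ → Matrix (Fin d) (Fin d) ℝ) (w : Finset (Meas d)) :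
    c.N H sq w = Matrix.vecMulVec ((sq c.extent * (sq (c.S H w))⁻¹) *ᵥ c.eps H w)
      ((sq c.extent * (sq (c.S H w))⁻¹) *ᵥ c.eps H w) := by
  rw [ExtComp.N, Matrix.mul_vecMulVec, Matrix.mul_assoc, ← Matrix.transpose_mul,
    Matrix.vecMulVec_mul, Matrix.vecMul_transpose]

theorem ExtComp.posDef_S (hc : c.Valid) (H : Matrix (Fin d) (Fin nx) ℝ) (hw : w.Nonempty) :
    (c.S H w).PosDef :=
  GaussComp.posDef_innovCov hc.1.2.2 H (posDef_meanNoise hw (c.posDef_extent hc))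

theorem ExtComp.posDef_update_V (hc : c.Valid) (ω : ℝ) : (c.update H sq w ω).V.PosDef := by
  refine (hc.2.2.2.2.add_posSemidef ?_).add_posSemidef (posSemidef_cellScatter w)
  rw [c.N_eq_vecMulVec]
  exact posSemidef_vecMulVec_self _

theorem ExtComp.Valid.update (hc : c.Valid) (hw : w.Nonempty) {ω : ℝ} (hω : 0 ≤ ω) :
    (c.update H sq w ω).Valid := by
  have hn : (0 : ℝ) ≤ w.card := Nat.cast_nonneg _
  refine ⟨hc.1.kalman H (posDef_meanNoise hw (c.posDef_extent hc)) _ hω, ?_, ?_, ?_,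
    c.posDef_update_V hc ω⟩
  · change 0 < c.a + w.card
    linarith [hc.2.1]
  · change 0 < c.b + 1
    linarith [hc.2.2.1]
  · change 2 * (d : ℝ) + 2 < c.v + w.card
    linarith [hc.2.2.2.1]

/-- The substituted innovation covariance is a congruence of the extent, so that the Gaussian
factor of the cell mean is an inverse-Wishart factor in the extent. -/
theorem ExtComp.ggiwInnov_det_quadratic (hc : c.Valid) (M : Sensor nx d)
    (hsq : ∀ E : Matrix (Fin d) (Fin d) ℝ, E.PosDef → sq E * (sq E)ᵀ = E) (hw : w.Nonempty)
    (E : Matrix (Fin d) (Fin d) ℝ) :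
    (c.ggiwInnov M sq w E).det = (c.S M.H w).det / c.extent.det * E.det ∧
      c.eps M.H w ⬝ᵥ ((c.ggiwInnov M sq w E)⁻¹ *ᵥ c.eps M.H w) = (c.N M.H sq w * E⁻¹).trace := by
  have hX := c.posDef_extent hc
  have hS := c.posDef_S hc M.H hw
  have hXd := (Matrix.isUnit_iff_isUnit_det _).1 (isUnit_of_mul_transpose_posDef hX (hsq _ hX))
  constructor
  · have e1 : (c.S M.H w).det = (sq (c.S M.H w)).det ^ 2 := by
      conv_lhs => rw [← hsq _ hS, Matrix.det_mul, Matrix.det_transpose, ← pow_two]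
    have e2 : c.extent.det = (sq c.extent).det ^ 2 := by
      conv_lhs => rw [← hsq _ hX, Matrix.det_mul, Matrix.det_transpose, ← pow_two]
    have e3 := hXd.ne_zero
    simp only [ExtComp.ggiwInnov]
    rw [e1, e2, Matrix.det_mul, Matrix.det_mul, Matrix.det_transpose, Matrix.det_mul,
      Matrix.det_nonsing_inv, Ring.inverse_eq_inv']
    field_simp
  · simp only [ExtComp.ggiwInnov]
    rw [c.N_eq_vecMulVec, ← dotProduct_mulVec_eq_trace, Matrix.mul_inv_rev, Matrix.mul_inv_rev,
      ← Matrix.transpose_nonsing_inv, Matrix.mul_inv_rev, Matrix.nonsing_inv_nonsing_inv _ hXd,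
      ← Matrix.mulVec_mulVec, Matrix.dotProduct_mulVec, Matrix.vecMul_transpose]
    simp only [Matrix.mulVec_mulVec]

/-- The inverse-Wishart density is conjugate to the scatter factor and the substituted Gaussian factor
of the cell mean; the constant is the extent part of the likelihood `q`. -/
theorem ExtComp.invWishart_conjugacy (hc : c.Valid) (M : Sensor nx d)
    (hsq : ∀ E : Matrix (Fin d) (Fin d) ℝ, E.PosDef → sq E * (sq E)ᵀ = E) (hw : w.Nonempty)
    {E : Matrix (Fin d) (Fin d) ℝ} (hE : E.PosDef) (V' : Matrix (Fin d) (Fin d) ℝ)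
    (hV' : V' = c.V + c.N M.H sq w + cellScatter w) (hV'pd : V'.PosDef) :
    scatterFactor w E * gaussPDF (M.H *ᵥ c.meanK) (c.ggiwInnov M sq w E) (cellMean w) *
        invWishartPDF c.v c.V E =
      (Real.pi ^ w.card * (w.card : ℝ)) ^ (-(d : ℝ) / 2) *
        (c.V.det ^ ((c.v - d - 1) / 2) / V'.det ^ ((c.v + w.card - d - 1) / 2)) *
        (multiGamma d ((c.v + w.card - d - 1) / 2) * c.extent.det ^ ((1 : ℝ) / 2) /
          (multiGamma d ((c.v - d - 1) / 2) * (c.S M.H w).det ^ ((1 : ℝ) / 2))) *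
        invWishartPDF (c.v + w.card) V' E := by
  obtain ⟨hdet, hquad⟩ := c.ggiwInnov_det_quadratic hc M hsq hw E
  have hn0 : 0 < (w.card : ℝ) := Nat.cast_pos.2 hw.card_pos
  have hv := hc.2.2.2.1
  have g1 : 0 < multiGamma d ((c.v - d - 1) / 2) := multiGamma_pos (by linarith)
  have g2 : 0 < multiGamma d ((c.v + w.card - d - 1) / 2) := multiGamma_pos (by linarith)
  have hE0 := hE.det_pos
  have hS0 := (c.posDef_S hc M.H hw).det_pos
  have hX0 := (c.posDef_extent hc).det_pos
  have hV0 := hV'pd.det_pos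
  have htr : (V' * E⁻¹).trace = (c.V * E⁻¹).trace + (c.N M.H sq w * E⁻¹).trace +
      (cellScatter w * E⁻¹).trace := by
    rw [hV', add_mul, add_mul, Matrix.trace_add, Matrix.trace_add]
  have hexp : Real.exp (-(1 / 2) * (V' * E⁻¹).trace) =
      Real.exp (-(1 / 2) * (c.V * E⁻¹).trace) * Real.exp (-(1 / 2) * (c.N M.H sq w * E⁻¹).trace) *
        Real.exp (-(1 / 2) * (cellScatter w * E⁻¹).trace) := by
    rw [← Real.exp_add, ← Real.exp_add, htr]
    congr 1; ring
  have hd : ((c.S M.H w).det / c.extent.det * E.det) ^ (-(1 : ℝ) / 2) =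
      c.extent.det ^ ((1 : ℝ) / 2) / (c.S M.H w).det ^ ((1 : ℝ) / 2) * E.det ^ (-(1 : ℝ) / 2) := by
    rw [Real.mul_rpow (by positivity) hE0.le, neg_div, Real.rpow_neg (by positivity),
      Real.div_rpow hS0.le hX0.le, inv_div]
  have hEp : E.det ^ (-((w.card : ℝ) - 1) / 2) * E.det ^ (-(1 : ℝ) / 2) =
      E.det ^ (c.v / 2) / E.det ^ ((c.v + w.card) / 2) := by
    rw [← Real.rpow_add hE0, ← Real.rpow_sub hE0]
    congr 1; ring
  have hpi : (2 * Real.pi) ^ (-((w.card : ℝ) - 1) * d / 2) * (2 * Real.pi) ^ (-(d : ℝ) / 2) *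
      (w.card : ℝ) ^ (-(d : ℝ) / 2) =
      (Real.pi ^ w.card * (w.card : ℝ)) ^ (-(d : ℝ) / 2) *
        (2 ^ ((c.v - d - 1) * d / 2) / 2 ^ ((c.v + w.card - d - 1) * d / 2)) := by
    rw [← Real.rpow_add (by positivity), ← Real.rpow_sub (by norm_num),
      Real.mul_rpow (by positivity) hn0.le, ← Real.rpow_natCast, ← Real.rpow_mul Real.pi_pos.le,
      Real.mul_rpow (by norm_num) Real.pi_pos.le]
    have e1 : -((w.card : ℝ) - 1) * d / 2 + -(d : ℝ) / 2 = w.card * (-(d : ℝ) / 2) := by ring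
    have e2 : (c.v - d - 1) * d / 2 - (c.v + w.card - d - 1) * d / 2 =
      w.card * (-(d : ℝ) / 2) := by ring
    rw [e1, e2]
    ring
  unfold scatterFactor gaussPDF invWishartPDF
  rw [← ExtComp.eps, hdet, hquad, hd, hexp, Fintype.card_fin]
  have p1 : 0 < E.det ^ (c.v / 2) := by positivity
  have p2 : 0 < E.det ^ ((c.v + w.card) / 2) := by positivity
  have p3 : (0 : ℝ) < 2 ^ ((c.v - d - 1) * d / 2) := by positivity
  have p4 : (0 : ℝ) < 2 ^ ((c.v + w.card - d - 1) * d / 2) := by positivity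
  have p5 : 0 < V'.det ^ ((c.v + w.card - d - 1) / 2) := by positivity
  have p6 : 0 < (c.S M.H w).det ^ ((1 : ℝ) / 2) := by positivity
  generalize Real.exp (-(1 / 2) * (c.V * E⁻¹).trace) = x1
  generalize Real.exp (-(1 / 2) * (c.N M.H sq w * E⁻¹).trace) = x2
  generalize Real.exp (-(1 / 2) * (cellScatter w * E⁻¹).trace) = x3
  generalize c.V.det ^ ((c.v - d - 1) / 2) = x4
  generalize c.extent.det ^ ((1 : ℝ) / 2) = x5
  generalize E.det ^ (-((w.card : ℝ) - 1) / 2) = y1 at *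
  generalize E.det ^ (-(1 : ℝ) / 2) = y2 at *
  generalize (2 * Real.pi) ^ (-((w.card : ℝ) - 1) * d / 2) = y3 at *
  generalize (2 * Real.pi) ^ (-(d : ℝ) / 2) = y4 at *
  generalize (w.card : ℝ) ^ (-(d : ℝ) / 2) = y5 at *
  generalize (Real.pi ^ w.card * (w.card : ℝ)) ^ (-(d : ℝ) / 2) = y6 at *
  generalize E.det ^ (c.v / 2) = q1 at *
  generalize E.det ^ ((c.v + w.card) / 2) = q2 at *
  generalize (2 : ℝ) ^ ((c.v - d - 1) * d / 2) = q3 at *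
  generalize (2 : ℝ) ^ ((c.v + w.card - d - 1) * d / 2) = q4 at *
  generalize V'.det ^ ((c.v + w.card - d - 1) / 2) = q5 at *
  generalize (c.S M.H w).det ^ ((1 : ℝ) / 2) = q6 at *
  generalize multiGamma d ((c.v - d - 1) / 2) = q7 at *
  generalize multiGamma d ((c.v + w.card - d - 1) / 2) = q8 at *
  calc _ = (y3 * y4 * y5) * (y1 * y2) * (x3 * x2 * x1 * (x5 / q6) * (x4 / (q3 * q7 * q1))) := by
        ring
    _ = _ := by
        rw [hpi, hEp]
        field_simp

/-- The substituted joint intensity of a cell and a GGIW component is a GGIW component again. -/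
theorem ExtComp.cellJoint_eq (hc : c.Valid) (M : Sensor nx d)
    (hsq : ∀ E : Matrix (Fin d) (Fin d) ℝ, E.PosDef → sq E * (sq E)ᵀ = E) (hw : w.Nonempty)
    (X : ExtState k nx d) :
    c.cellJoint M w (c.ggiwInnov M sq w) (fun _ => c.extent) X =
      (c.update M.H sq w (c.weight * M.pD * c.q M.H sq w)).phd X := by
  have h1 := poisson_mul_gammaPDFReal hc.2.1 hc.2.2.1 X.2.1.2 w.card
  have h2 := c.invWishart_conjugacy hc M hsq hw X.2.2.2 (c.update M.H sq w 1).V rfl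
    (c.posDef_update_V hc 1)
  have hphd : (c.update M.H sq w (c.weight * M.pD * c.q M.H sq w)).phd X =
      c.weight * M.pD * c.q M.H sq w *
        ProbabilityTheory.gammaPDFReal (c.a + w.card) (c.b + 1) X.2.1 *
        (c.kalman M.H (meanNoise w c.extent) (cellMean w) 1).density X.1 *
        invWishartPDF (c.v + w.card) (c.update M.H sq w 1).V X.2.2.1 := rfl
  have hq : c.q M.H sq w = (Real.pi ^ w.card * (w.card : ℝ)) ^ (-(d : ℝ) / 2) *
        (c.V.det ^ ((c.v - d - 1) / 2) /
          (c.update M.H sq w 1).V.det ^ ((c.v + w.card - d - 1) / 2)) *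
        (multiGamma d ((c.v + w.card - d - 1) / 2) * c.extent.det ^ ((1 : ℝ) / 2) /
          (multiGamma d ((c.v - d - 1) / 2) * (c.S M.H w).det ^ ((1 : ℝ) / 2))) *
        (Real.Gamma (c.a + w.card) * c.b ^ c.a /
          (Real.Gamma c.a * (c.b + 1) ^ (c.a + w.card))) := by
    rw [mul_assoc, ← mul_div_mul_comm, ← mul_assoc, ← mul_assoc]
    rfl
  rw [hphd, hq]
  simp only [ExtComp.cellJoint]
  generalize Real.Gamma (c.a + w.card) * c.b ^ c.a /
          (Real.Gamma c.a * (c.b + 1) ^ (c.a + w.card)) = G at *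
  calc _ = c.weight * M.pD * ((X.2.1 : ℝ) ^ w.card * Real.exp (-(X.2.1 : ℝ)) *
          ProbabilityTheory.gammaPDFReal c.a c.b X.2.1) *
        (scatterFactor w X.2.2.1 * gaussPDF (M.H *ᵥ c.meanK) (c.ggiwInnov M sq w X.2.2.1)
          (cellMean w) * invWishartPDF c.v c.V X.2.2.1) *
        (c.kalman M.H (meanNoise w c.extent) (cellMean w) 1).density X.1 := by ring
    _ = _ := by
        rw [h1, h2]
        ring

theorem ExtComp.update_phd (c : ExtComp k nx d) (H : Matrix (Fin d) (Fin nx) ℝ)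
    (sq : Matrix (Fin d) (Fin d) ℝ → Matrix (Fin d) (Fin d) ℝ) (w : Finset (Meas d)) (ω : ℝ)
    (X : ExtState k nx d) :
    (c.update H sq w ω).phd X = ω * (c.update H sq w 1).phd X := by
  have h : (c.update H sq w ω).phd X =
      ω * ProbabilityTheory.gammaPDFReal (c.update H sq w 1).a (c.update H sq w 1).b X.2.1 *
        (c.update H sq w 1).density X.1 *
        invWishartPDF (c.update H sq w 1).v (c.update H sq w 1).V X.2.2.1 := rfl
  have hw : (c.update H sq w 1).weight = 1 := rfl
  rw [h, ExtComp.phd, hw]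
  ring

theorem ExtComp.q_nonneg (hc : c.Valid) (hw : w.Nonempty) : 0 ≤ c.q H sq w := by
  have hn0 : 0 < (w.card : ℝ) := Nat.cast_pos.2 hw.card_pos
  have hv := hc.2.2.2.1
  have ha := hc.2.1
  have hb := hc.2.2.1
  have g1 : 0 < multiGamma d ((c.v - d - 1) / 2) := multiGamma_pos (by linarith)
  have g2 : 0 < multiGamma d ((c.v + w.card - d - 1) / 2) := multiGamma_pos (by linarith)
  have g3 := Real.Gamma_pos_of_pos ha
  have g4 := Real.Gamma_pos_of_pos (add_pos ha hn0)
  have hS0 := (c.posDef_S hc H hw).det_pos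
  have hX0 := (c.posDef_extent hc).det_pos
  have hV0 := hc.2.2.2.2.det_pos
  have hV1 := (c.posDef_update_V (H := H) (sq := sq) (w := w) hc 1).det_pos
  simp only [ExtComp.q]
  change 0 ≤ _ * _ * ((multiGamma d ((c.v + w.card - d - 1) / 2) * _ *
    Real.Gamma (c.a + w.card) * _) / (_ * _ * _ * (c.b + 1) ^ (c.a + w.card)))
  positivity

theorem GaussComp.q_nonneg {g : GaussComp k nx} (hg : g.Valid) {M : Sensor nx d}
    (hR : M.R.PosDef) (w : Finset (Meas d)) : 0 ≤ g.q M w :=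
  gaussPDF_nonneg _ (GaussComp.posDef_innovCov hg.2.2 M.H hR) _

end Conjugacy

/-! ### The posterior mixture -/

section Posterior

variable {k nx d Jp Je : ℕ}

/-- The Gaussian component that a point-target component contributes to the joint intensity of a
cell: its Kalman update, weighted with the likelihood. -/
noncomputable def pointCell (M : Sensor nx d) (pc : Fin Jp → GaussComp k nx) (w : Finset (Meas d))
    (i : Fin Jp) : GaussComp k nx :=
  (pc i).kalman M.H M.R (cellMean w)
    ((pc i).weight * M.pD * (pc i).q M w * (if w.card = 1 then 1 else 0))

/-- The GGIW component that an extended-target component contributes to the joint intensity of a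
cell. -/
noncomputable def extCell (M : Sensor nx d)
    (sq : Matrix (Fin d) (Fin d) ℝ → Matrix (Fin d) (Fin d) ℝ)
    (ec : Fin Je → ExtComp k nx d) (w : Finset (Meas d)) (j : Fin Je) : ExtComp k nx d :=
  (ec j).update M.H sq w ((ec j).weight * M.pD * (ec j).q M.H sq w)

variable {M : Sensor nx d} {sq : Matrix (Fin d) (Fin d) ℝ → Matrix (Fin d) (Fin d) ℝ}
  {pc : Fin Jp → GaussComp k nx} {ec : Fin Je → ExtComp k nx d}

theorem pointCell_valid (hR : M.R.PosDef) (hpD : 0 ≤ M.pD) (hpc : ∀ i, (pc i).Valid)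
    (w : Finset (Meas d)) (i : Fin Jp) : (pointCell M pc w i).Valid := by
  refine (hpc i).kalman M.H hR _ ?_
  have h1 := (hpc i).1
  have h2 := GaussComp.q_nonneg (hpc i) hR w
  split_ifs <;> positivity

theorem extCell_valid (hpD : 0 ≤ M.pD) (hec : ∀ j, (ec j).Valid) {w : Finset (Meas d)}
    (hw : w.Nonempty) (j : Fin Je) : (extCell M sq ec w j).Valid := by
  refine (hec j).update hw ?_
  have h1 := (hec j).1.1
  have h2 := ExtComp.q_nonneg (H := M.H) (sq := sq) (hec j) hw
  positivity

theorem ggiwJoint_eq_mixturePHD (hR : M.R.PosDef)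
    (hsq : ∀ E : Matrix (Fin d) (Fin d) ℝ, E.PosDef → sq E * (sq E)ᵀ = E)
    (hpc : ∀ i, (pc i).Valid) (hec : ∀ j, (ec j).Valid) {w : Finset (Meas d)} (hw : w.Nonempty) :
    ggiwJoint M sq pc ec w = mixturePHD (pointCell M pc w) (extCell M sq ec w) := by
  have hn : w.card ≠ 0 := hw.card_pos.ne'
  funext X
  rcases X with X | X
  · simp only [ggiwJoint, joint, mixturePHD, Sensor.lik, if_neg hn, Finset.mul_sum]
    refine Finset.sum_congr rfl fun i _ => ?_
    have hphd : (pointCell M pc w i).phd X =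
      (pc i).weight * M.pD * (pc i).q M w * (if w.card = 1 then 1 else 0) *
        ((pc i).kalman M.H M.R (cellMean w) 1).density X := rfl
    rw [hphd]
    by_cases h1 : w.card = 1
    · obtain ⟨z, rfl⟩ := Finset.card_eq_one.1 h1
      have hz : cellMean ({z} : Finset (Meas d)) = z := by simp [cellMean]
      have hk := GaussComp.gaussPDF_mul_density (hpc i).2.2 M.H hR z 1 X
      rw [if_pos h1, if_pos h1, Finset.prod_singleton, GaussComp.phd, GaussComp.q, hz]
      linear_combination M.pD * (pc i).weight * hk
    · rw [if_neg h1, if_neg h1]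
      ring
  · simp only [ggiwJoint, joint, mixturePHD, if_neg hn]
    exact Finset.sum_congr rfl fun j _ => (ec j).cellJoint_eq (hec j) M hsq hw X

theorem tau_ggiwJoint (hR : M.R.PosDef) (hpD : 0 ≤ M.pD)
    (hsq : ∀ E : Matrix (Fin d) (Fin d) ℝ, E.PosDef → sq E * (sq E)ᵀ = E)
    (hpc : ∀ i, (pc i).Valid) (hec : ∀ j, (ec j).Valid) {w : Finset (Meas d)} (hw : w.Nonempty) :
    tau (ggiwJoint M sq pc ec) w =
      ∑ i, (pc i).weight * M.pD * (pc i).q M w * (if w.card = 1 then 1 else 0) +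
        ∑ j, (ec j).weight * M.pD * (ec j).q M.H sq w := by
  rw [tau, ggiwJoint_eq_mixturePHD hR hsq hpc hec hw]
  exact (mixturePHD_integrable_integral _ _ (pointCell_valid hR hpD hpc w)
    (extCell_valid hpD hec hw)).2

/-- The cell factors `κ_𝐰 + τ_𝐰` and `d_𝐰` differ by the product of the clutter intensities. -/
theorem kappa_add_tau (hR : M.R.PosDef) (hpD : 0 ≤ M.pD)
    (hsq : ∀ E : Matrix (Fin d) (Fin d) ℝ, E.PosDef → sq E * (sq E)ᵀ = E)
    (hpc : ∀ i, (pc i).Valid) (hec : ∀ j, (ec j).Valid) {w : Finset (Meas d)} (hw : w.Nonempty)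
    (hC : ∏ z ∈ w, M.clutter z ≠ 0) :
    kappa M.clutter w + tau (ggiwJoint M sq pc ec) w =
      (∏ z ∈ w, M.clutter z) * cellFactor M sq pc ec w := by
  rw [tau_ggiwJoint hR hpD hsq hpc hec hw, kappa, cellFactor, mul_add, mul_add, Finset.mul_sum,
    Finset.mul_sum]
  have h0 : (∏ z ∈ w, M.clutter z) * (if w.card = 1 then 1 else 0) =
      if w.card = 1 then ∏ z ∈ w, M.clutter z else 0 := by
    rw [mul_ite, mul_one, mul_zero]
  have h1 : ∀ i, (∏ z ∈ w, M.clutter z) * ((pc i).weight * M.pD *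
      ((pc i).q M w / ∏ z ∈ w, M.clutter z) * (if w.card = 1 then 1 else 0)) =
      (pc i).weight * M.pD * (pc i).q M w * (if w.card = 1 then 1 else 0) := fun i => by
    field_simp
  have h2 : ∀ j, (∏ z ∈ w, M.clutter z) * ((ec j).weight * M.pD *
      ((ec j).q M.H sq w / ∏ z ∈ w, M.clutter z)) =
      (ec j).weight * M.pD * (ec j).q M.H sq w := fun j => by
    field_simp
  simp only [h0, h1, h2]
  ring

/-- Cell factors that differ by a product over the points of the cell give the same partition weights,
since that product over all cells of a partition does not depend on the partition. -/
theorem partWeight_congr {z : Finset (Meas d)} {h h' : Finset (Meas d) → ℝ} {lamC : Meas d → ℝ}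
    (hC : ∏ y ∈ z, lamC y ≠ 0)
    (hh : ∀ P : Finpartition z, ∀ w ∈ P.parts, h w = (∏ y ∈ w, lamC y) * h' w)
    (P : Finpartition z) : partWeight h P = partWeight h' P := by
  have hprod : ∀ Q : Finpartition z,
      ∏ w ∈ Q.parts, h w = (∏ y ∈ z, lamC y) * ∏ w ∈ Q.parts, h' w := fun Q => by
    rw [Finset.prod_congr rfl (hh Q), Finset.prod_mul_distrib]
    congr 1
    have := Finset.prod_biUnion (f := lamC) (t := id) Q.disjoint
    rw [Q.biUnion_parts] at this
    exact this.symm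
  simp only [partWeight, hprod]
  rw [← Finset.mul_sum, mul_div_mul_left _ _ hC]

/-- The missed-detection part is the joint intensity of the empty cell. -/
theorem ggiwJoint_empty (hec : ∀ j, (ec j).Valid) :
    ggiwJoint M sq pc ec ∅ = missedPHD M pc ec := by
  funext X
  rcases X with X | X
  · simp only [ggiwJoint, joint, missedPHD, Sensor.lik, Finset.card_empty, if_true, Finset.mul_sum,
      GaussComp.phd, mul_assoc]
  · simp only [ggiwJoint, joint, missedPHD, Sensor.lik, Finset.card_empty, if_true, Finset.mul_sum]
    refine Finset.sum_congr rfl fun j _ => ?_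
    have ha := (hec j).2.1
    have hb := (hec j).2.2.1
    have hG := poisson_mul_gammaPDFReal ha hb X.2.1.2 0
    have hc : Real.Gamma ((ec j).a + (0 : ℕ)) * (ec j).b ^ (ec j).a /
        (Real.Gamma (ec j).a * ((ec j).b + 1) ^ ((ec j).a + (0 : ℕ))) =
        ((ec j).b / ((ec j).b + 1)) ^ (ec j).a := by
      have := (Real.Gamma_pos_of_pos ha).ne'
      rw [Nat.cast_zero, add_zero, Real.div_rpow hb.le (by linarith), mul_div_mul_left _ _ this]
    rw [hc, Nat.cast_zero, add_zero, pow_zero, one_mul] at hG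
    rw [ExtComp.phd]
    linear_combination (M.pD * (ec j).weight * (ec j).density X.1 *
      invWishartPDF (ec j).v (ec j).V X.2.2.1) * hG

theorem integrable_missedPHD (hpD : 0 ≤ M.pD ∧ M.pD ≤ 1) (hpc : ∀ i, (pc i).Valid)
    (hec : ∀ j, (ec j).Valid) : Integrable (missedPHD M pc ec) (coVolume k nx d) := by
  have hq : 0 ≤ 1 - M.pD := by linarith [hpD.2]
  -- the two summands of each extended component are separate GGIW components
  let pc' : Fin Jp → GaussComp k nx := fun i =>
    { pc i with weight := (1 - M.pD) * (pc i).weight }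
  let ec1 : Fin Je → ExtComp k nx d := fun j =>
    { ec j with weight := (1 - M.pD) * (ec j).weight }
  let ec2 : Fin Je → ExtComp k nx d := fun j =>
    { ec j with
      weight := M.pD * ((ec j).b / ((ec j).b + 1)) ^ (ec j).a * (ec j).weight
      b := (ec j).b + 1 }
  have hpc' : ∀ i, (pc' i).Valid := fun i => ⟨mul_nonneg hq (hpc i).1, (hpc i).2⟩
  have hec1 : ∀ j, (ec1 j).Valid := fun j =>
    ⟨⟨mul_nonneg hq (hec j).1.1, (hec j).1.2⟩, (hec j).2⟩
  have hec2 : ∀ j, (ec2 j).Valid := fun j => by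
    have h1 := (hec j).1.1
    have h2 := (hec j).2.2.1
    have h3 := hpD.1
    refine ⟨⟨?_, (hec j).1.2⟩, (hec j).2.1, ?_, (hec j).2.2.2⟩
    · change 0 ≤ M.pD * ((ec j).b / ((ec j).b + 1)) ^ (ec j).a * (ec j).weight
      positivity
    · change 0 < (ec j).b + 1
      positivity
  have h1 := (mixturePHD_integrable_integral pc' ec1 hpc' hec1).1
  have h2 := (mixturePHD_integrable_integral (Fin.elim0 : Fin 0 → GaussComp k nx) ec2
    (fun i => i.elim0) hec2).1
  refine (h1.add h2).congr (ae_of_all _ fun X => ?_)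
  rcases X with X | X
  · simp only [Pi.add_apply, mixturePHD, missedPHD, Finset.univ_eq_empty, Finset.sum_empty,
      add_zero]
    rfl
  · simp only [Pi.add_apply, mixturePHD, missedPHD]
    rw [← Finset.sum_add_distrib]
    refine Finset.sum_congr rfl fun j _ => ?_
    change (1 - M.pD) * (ec j).weight *
        ProbabilityTheory.gammaPDFReal (ec j).a (ec j).b X.2.1 * (ec j).density X.1 *
        invWishartPDF (ec j).v (ec j).V X.2.2.1 +
      M.pD * ((ec j).b / ((ec j).b + 1)) ^ (ec j).a * (ec j).weight *
        ProbabilityTheory.gammaPDFReal (ec j).a ((ec j).b + 1) X.2.1 * (ec j).density X.1 *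
        invWishartPDF (ec j).v (ec j).V X.2.2.1 = _
    ring

/-- With a vanishing `d_𝐰` both sides are zero, as both are quotients by `d_𝐰`. -/
theorem detectedPHD_eq {z : Finset (Meas d)} (P : Finpartition z) (w : Finset (Meas d))
    (X : CoState k nx d) :
    detectedPHD M sq pc ec P w X =
      partWeight (cellFactor M sq pc ec) P *
        (mixturePHD (pointCell M pc w) (extCell M sq ec w) X /
          ((∏ y ∈ w, M.clutter y) * cellFactor M sq pc ec w)) := by
  rcases X with X | X
  · simp only [detectedPHD, mixturePHD, Finset.sum_div, Finset.mul_sum]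
    refine Finset.sum_congr rfl fun i _ => ?_
    change pointWeight M sq pc ec P w i *
        ((pc i).kalman M.H M.R (cellMean w) 1).density X =
      _ * ((pc i).weight * M.pD * (pc i).q M w * (if w.card = 1 then 1 else 0) *
        ((pc i).kalman M.H M.R (cellMean w) 1).density X / _)
    rw [pointWeight, ← div_div]
    ring
  · simp only [detectedPHD, mixturePHD, Finset.sum_div, Finset.mul_sum]
    refine Finset.sum_congr rfl fun j _ => ?_
    change ((ec j).update M.H sq w (extWeight M sq pc ec P w j)).phd X =
      _ * (((ec j).update M.H sq w ((ec j).weight * M.pD * (ec j).q M.H sq w)).phd X / _)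
    rw [ExtComp.update_phd, (ec j).update_phd M.H sq w ((ec j).weight * M.pD * (ec j).q M.H sq w),
      extWeight, ← div_div]
    ring

theorem cellFactor_nonneg (hR : M.R.PosDef) (hpD : 0 ≤ M.pD) (hpc : ∀ i, (pc i).Valid)
    (hec : ∀ j, (ec j).Valid) {w : Finset (Meas d)} (hw : w.Nonempty)
    (hC : 0 < ∏ z ∈ w, M.clutter z) : 0 ≤ cellFactor M sq pc ec w := by
  have h1 : (0 : ℝ) ≤ if w.card = 1 then 1 else 0 := by split_ifs <;> norm_num
  refine add_nonneg (add_nonneg h1 (Finset.sum_nonneg fun j _ => ?_))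
    (Finset.sum_nonneg fun i _ => ?_)
  · have h2 := (hec j).1.1
    have h3 := ExtComp.q_nonneg (H := M.H) (sq := sq) (hec j) hw
    positivity
  · have h2 := (hpc i).1
    have h3 := GaussComp.q_nonneg (hpc i) hR w
    positivity

end Posterior

end TPHD

open TPHD
theorem proposition3 {k nx d Jp Je : ℕ} (M : Sensor nx d)
    (sq : Matrix (Fin d) (Fin d) ℝ → Matrix (Fin d) (Fin d) ℝ)
    (pc : Fin Jp → GaussComp k nx) (ec : Fin Je → ExtComp k nx d) (z : Finset (Meas d))
    (hR : M.R.PosDef) (hpD : 0 ≤ M.pD ∧ M.pD ≤ 1) (hclutter : ∀ y ∈ z, 0 < M.clutter y)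
    (hsq : ∀ E : Matrix (Fin d) (Fin d) ℝ, E.PosDef → sq E * (sq E)ᵀ = E)
    (hpc : ∀ i, (pc i).Valid) (hec : ∀ j, (ec j).Valid) :
    -- the exact update is the update for the exact Kalman-factorised joint intensity
    (∀ X : CoState k nx d,
      phdUpdate M.clutter z M.lik (mixturePHD pc ec) X =
        jointUpdate M.clutter z (exactJoint M pc ec) X) ∧
    -- the substituted innovation covariance agrees with the exact one at the predicted extent
    (∀ j, ∀ w : Finset (Meas d), w.Nonempty →
      (ec j).ggiwInnov M sq w (ec j).extent = (ec j).exactInnov M w (ec j).extent) ∧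
    -- all integrals of the GGIW scheme converge
    (∀ w : Finset (Meas d), Integrable (ggiwJoint M sq pc ec w) (coVolume k nx d)) ∧
    -- the posterior PHD of the GGIW scheme in closed form
    (∀ X : CoState k nx d,
      jointUpdate M.clutter z (ggiwJoint M sq pc ec) X =
        missedPHD M pc ec X +
          ∑ P : Finpartition z, ∑ w ∈ P.parts, detectedPHD M sq pc ec P w X) ∧
    -- the updated components are admissible
    (∀ P : Finpartition z, ∀ w ∈ P.parts,
      (∀ i, (pointDetected M sq pc ec P w i).Valid) ∧
      (∀ j, (extDetected M sq pc ec P w j).Valid)) := by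
  have hC : ∀ P : Finpartition z, ∀ w ∈ P.parts, 0 < ∏ y ∈ w, M.clutter y := fun P w hw =>
    Finset.prod_pos fun y hy => hclutter y (P.le hw hy)
  have hCz : ∏ y ∈ z, M.clutter y ≠ 0 := (Finset.prod_pos hclutter).ne'
  have hne : ∀ P : Finpartition z, ∀ w ∈ P.parts, w.Nonempty := fun P w hw =>
    P.nonempty_of_mem_parts hw
  have hfac : ∀ P : Finpartition z, ∀ w ∈ P.parts,
      kappa M.clutter w + tau (ggiwJoint M sq pc ec) w =
        (∏ y ∈ w, M.clutter y) * cellFactor M sq pc ec w := fun P w hw =>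
    kappa_add_tau hR hpD.1 hsq hpc hec (hne P w hw) (hC P w hw).ne'
  refine ⟨fun X => ?_, fun j w hw => (ec j).ggiwInnov_extent (hec j) M hsq hw, fun w => ?_,
    fun X => ?_, fun P w hw => ?_⟩
  · have h : (fun w Y => M.lik w Y * mixturePHD pc ec Y) = exactJoint M pc ec :=
      funext fun w => funext fun Y => lik_mul_mixturePHD M pc ec hec w Y
    rw [phdUpdate_eq_jointUpdate, h]
  · rcases w.eq_empty_or_nonempty with rfl | hw
    · rw [ggiwJoint_empty hec]
      exact integrable_missedPHD hpD hpc hec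
    · rw [ggiwJoint_eq_mixturePHD hR hsq hpc hec hw]
      exact (mixturePHD_integrable_integral _ _ (pointCell_valid hR hpD.1 hpc w)
        (extCell_valid hpD.1 hec hw)).1
  · rw [jointUpdate, ggiwJoint_empty hec]
    congr 1
    refine Finset.sum_congr rfl fun P _ => ?_
    rw [partWeight_congr hCz hfac P, Finset.mul_sum]
    refine Finset.sum_congr rfl fun w hw => ?_
    rw [detectedPHD_eq, hfac P w hw, ggiwJoint_eq_mixturePHD hR hsq hpc hec (hne P w hw)]
  · have hd : ∀ Q : Finpartition z, ∀ w ∈ Q.parts, 0 ≤ cellFactor M sq pc ec w :=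
      fun Q w hw => cellFactor_nonneg hR hpD.1 hpc hec (hne Q w hw) (hC Q w hw)
    have hP : 0 ≤ partWeight (cellFactor M sq pc ec) P :=
      div_nonneg (Finset.prod_nonneg (hd P))
        (Finset.sum_nonneg fun Q _ => Finset.prod_nonneg (hd Q))
    have h0 := hd P w hw
    have h1 := hC P w hw
    have h2 := hpD.1
    refine ⟨fun i => (hpc i).kalman M.H hR _ ?_, fun j => (hec j).update (hne P w hw) ?_⟩
    · have h3 := (hpc i).1
      have h4 := GaussComp.q_nonneg (hpc i) hR w
      rw [pointWeight]
      split_ifs <;> positivity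
    · have h3 := (hec j).1.1
      have h4 := ExtComp.q_nonneg (H := M.H) (sq := sq) (hec j) (hne P w hw)
      rw [extWeight]
      positivity
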